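/- Let $m\ge 1$ and let $\gamma=(\gamma_1,\dots,\gamma_m)\in\mathbb N^m$ satisfy $2\le\gamma_1\le\dots\le\gamma_m$; put $d=\gamma_1+\dots+\gamma_m$ and let $w_\gamma(r)=\prod_{i=1}^m|r_i|^{\gamma_i-1}$, $r\in\mathbb R^m$. For $\nu\in\mathbb N_0$ and $k\in\mathbb Z^m$ let $Q_{\nu,k}\subset\mathbb R^m$ be the cube with sides parallel to the axes, centre $2^{-\nu}k$ and side length $2^{-\nu}$, and let $w_\gamma(Q_{\nu,k})=\int_{Q_{\nu,k}}w_\gamma(x)\,dx$. For $\sigma\in\mathbb R$ and $0<p,q\le\infty$ let $b^{\sigma}_{p,q}(w_\gamma)$ be the (quasi-)normed space of all families $\lambda=(\lambda_{\nu,k})_{\nu\in\mathbb N_0,\,k\in\mathbb Z^m}$ of complex numbers with $$\|\lambda\,|\,b^{\sigma}_{p,q}(w_\gamma)\|=\Big(\sum_{\nu=0}^\infty 2^{\nu\sigma q}\Big(\sum_{k\in\mathbb Z^m}|\lambda_{\nu,k}|^p\,2^{m\nu}\,w_\gamma(Q_{\nu,k})\Big)^{q/p}\Big)^{1/q}<\infty,$$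 where for $p=\infty$ the inner expression $(\sum_{k}\dots)^{1/p}$ is replaced by $\sup_k|\lambda_{\nu,k}|$, and for $q=\infty$ the outer sum is replaced by a supremum over $\nu$. A bounded linear operator $T:X\to Y$ between (quasi-)Banach spaces is called nuclear if there are bounded linear functionals $a_j$ on $X$ and elements $y_j\in Y$, $j\in\mathbb N_0$, such that $\sum_{j}\|a_j\|\,\|y_j\|_Y<\infty$ and $Tx=\sum_{j=0}^{\infty}a_j(x)\,y_j$, with convergence in $Y$, for every $x\in X$. Let $1\le p_1,p_2\le\infty$, $0<q_1,q_2\le\infty$, $s_1,s_2\in\mathbb R$ and $\sigma_i=s_i+\frac m2-\frac m{p_i}$, $i=1,2$ (with $\frac1\infty=0$). Then $b^{\sigma_1}_{p_1,q_1}(w_\gamma)$ is contained in $b^{\sigma_2}_{p_2,q_2}(w_\gamma)$ with nuclear identity map $$\mathrm{id}:\ b^{\sigma_1}_{p_1,q_1}(w_\gamma)\to b^{\sigma_2}_{p_2,q_2}(w_\gamma)$$ if and only if $$\frac{s_1-s_2}{d}>\frac1{p_1}-\frac1{p_2}>\frac1{\gamma_1}.$$ -/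

import Mathlib

open MeasureTheory Filter Topology
open scoped ENNReal

noncomputable section

/-! ### Weighted `ℓ_p` quasi-norms -/

/-- The weighted `ℓ_p` quasi-norm `(∑ i, f i ^ p * W i) ^ (1 / p)` of a nonnegative family, read as
the supremum `sup_i f i` if `p = ∞`. -/
def weightedLpNorm {ι : Type*} (p : ℝ≥0∞) (W f : ι → ℝ≥0∞) : ℝ≥0∞ :=
  if p = ∞ then ⨆ i, f i else (∑' i, f i ^ p.toReal * W i) ^ (1 / p.toReal)

theorem ennreal_add_rpow_le {t : ℝ} (ht : 0 ≤ t) (a b : ℝ≥0∞) :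
    (a + b) ^ t ≤ 2 ^ t * (a ^ t + b ^ t) := by
  rcases le_total a b with h | h
  · calc (a + b) ^ t ≤ (2 * b) ^ t := by
          refine ENNReal.rpow_le_rpow ?_ ht
          rw [two_mul]; gcongr
      _ = 2 ^ t * b ^ t := ENNReal.mul_rpow_of_nonneg _ _ ht
      _ ≤ _ := by gcongr; exact le_add_self
  · calc (a + b) ^ t ≤ (2 * a) ^ t := by
          refine ENNReal.rpow_le_rpow ?_ ht
          rw [two_mul]; gcongr
      _ = 2 ^ t * a ^ t := ENNReal.mul_rpow_of_nonneg _ _ ht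
      _ ≤ _ := by gcongr; exact le_self_add

theorem weightedLpNorm_add_le {ι : Type*} (p : ℝ≥0∞) :
    ∃ C : ℝ≥0∞, C ≠ ∞ ∧ ∀ W f g h : ι → ℝ≥0∞, (∀ i, h i ≤ f i + g i) →
      weightedLpNorm p W h ≤ C * (weightedLpNorm p W f + weightedLpNorm p W g) := by
  by_cases hp : p = ∞
  · refine ⟨1, by simp, fun W f g h hh => ?_⟩
    simp only [weightedLpNorm, hp, if_true, one_mul]
    exact iSup_le fun i => (hh i).trans (add_le_add (le_iSup f i) (le_iSup g i))
  · set t := p.toReal with htdef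
    have ht : 0 ≤ t := ENNReal.toReal_nonneg
    have ht' : 0 ≤ 1 / t := by positivity
    refine ⟨(2 ^ t) ^ (1 / t) * 2 ^ (1 / t), ?_, fun W f g h hh => ?_⟩
    · exact ENNReal.mul_ne_top
        (ENNReal.rpow_ne_top_of_nonneg ht' (ENNReal.rpow_ne_top_of_nonneg ht (by simp)))
        (ENNReal.rpow_ne_top_of_nonneg ht' (by simp))
    · simp only [weightedLpNorm, hp, if_false, ← htdef]
      have key : ∑' i, h i ^ t * W i ≤
          2 ^ t * (∑' i, f i ^ t * W i + ∑' i, g i ^ t * W i) := by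
        rw [← ENNReal.tsum_add, ← ENNReal.tsum_mul_left]
        refine ENNReal.tsum_le_tsum fun i => ?_
        calc h i ^ t * W i ≤ (2 ^ t * (f i ^ t + g i ^ t)) * W i := by
              gcongr
              exact (ENNReal.rpow_le_rpow (hh i) ht).trans (ennreal_add_rpow_le ht _ _)
          _ = _ := by ring
      calc _ ≤ _ := ENNReal.rpow_le_rpow key ht'
        _ = (2 ^ t) ^ (1 / t) * (∑' i, f i ^ t * W i + ∑' i, g i ^ t * W i) ^ (1 / t) :=
            ENNReal.mul_rpow_of_nonneg _ _ ht'
        _ ≤ _ := by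
            rw [mul_assoc]
            gcongr
            exact ennreal_add_rpow_le ht' _ _

theorem weightedLpNorm_mul_le {ι : Type*} (p : ℝ≥0∞) (c : ℝ≥0∞) (hc : c ≠ ∞) :
    ∃ C : ℝ≥0∞, C ≠ ∞ ∧ ∀ W f h : ι → ℝ≥0∞, (∀ i, h i ≤ c * f i) →
      weightedLpNorm p W h ≤ C * weightedLpNorm p W f := by
  by_cases hp : p = ∞
  · refine ⟨c, hc, fun W f h hh => ?_⟩
    simp only [weightedLpNorm, hp, if_true]
    exact iSup_le fun i => (hh i).trans (by gcongr; exact le_iSup f i)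
  · set t := p.toReal with htdef
    have ht : 0 ≤ t := ENNReal.toReal_nonneg
    have ht' : 0 ≤ 1 / t := by positivity
    refine ⟨(c ^ t) ^ (1 / t),
      ENNReal.rpow_ne_top_of_nonneg ht' (ENNReal.rpow_ne_top_of_nonneg ht hc), fun W f h hh => ?_⟩
    simp only [weightedLpNorm, hp, if_false, ← htdef]
    rw [← ENNReal.mul_rpow_of_nonneg _ _ ht', ← ENNReal.tsum_mul_left]
    refine ENNReal.rpow_le_rpow (ENNReal.tsum_le_tsum fun i => ?_) ht'
    rw [← mul_assoc, ← ENNReal.mul_rpow_of_nonneg _ _ ht]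
    gcongr
    exact hh i

theorem weightedLpNorm_zero {ι : Type*} {p : ℝ≥0∞} (h0 : p ≠ 0) (W : ι → ℝ≥0∞) :
    weightedLpNorm p W (fun _ => 0) = 0 := by
  by_cases hp : p = ∞
  · simp [weightedLpNorm, hp]
  · have h : 0 < p.toReal := ENNReal.toReal_pos h0 hp
    simp [weightedLpNorm, hp, ENNReal.zero_rpow_of_pos h, h]

/-! ### Dyadic cubes and the block weight -/

/-- The dyadic cube `Q_{ν,k}` in `ℝ^m`, centred at `2^{-ν} k` with side length `2^{-ν}`. -/
def dyadicCube {m : ℕ} (ν : ℕ) (k : Fin m → ℤ) : Set (Fin m → ℝ) :=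
  {x | ∀ i, |x i - (2 : ℝ) ^ (-(ν : ℤ)) * (k i : ℝ)| ≤ (2 : ℝ) ^ (-(ν : ℤ)) / 2}

/-- The mass `w(Q) = ∫_Q w(x) dx` of a set for a nonnegative weight `w`. -/
def weightMass {m : ℕ} (w : (Fin m → ℝ) → ℝ) (Q : Set (Fin m → ℝ)) : ℝ≥0∞ :=
  ∫⁻ x in Q, ENNReal.ofReal (w x)

/-- The weight `w_γ(r) = ∏ |r_i| ^ (γ_i - 1)` on `ℝ^m` (used for `γ_i ≥ 1`). -/
def blockWeight {m : ℕ} (γ : Fin m → ℕ) (r : Fin m → ℝ) : ℝ :=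
  ∏ i, |r i| ^ (γ i - 1)

/-! ### The weighted sequence spaces `b^σ_{p,q}(w)` -/

/-- The extended quasi-norm
`(∑_ν 2^{νσq} (∑_k |λ_{ν,k}|^p 2^{mν} w(Q_{ν,k}))^{q/p})^{1/q}`,
with the inner (outer) sum replaced by a supremum if `p = ∞` (`q = ∞`); in particular the weight
does not enter if `p = ∞`. -/
def besovSeqENorm {m : ℕ} (w : (Fin m → ℝ) → ℝ) (σ : ℝ) (p q : ℝ≥0∞)
    (lam : ℕ → (Fin m → ℤ) → ℂ) : ℝ≥0∞ :=
  weightedLpNorm q (fun _ : ℕ => 1) fun ν =>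
    (2 : ℝ≥0∞) ^ ((ν : ℝ) * σ) *
      weightedLpNorm p (fun k => 2 ^ (m * ν) * weightMass w (dyadicCube ν k)) fun k => ‖lam ν k‖ₑ

theorem besovSeqENorm_add_lt_top {m : ℕ} {w : (Fin m → ℝ) → ℝ} {σ : ℝ} {p q : ℝ≥0∞}
    {x y : ℕ → (Fin m → ℤ) → ℂ} (hx : besovSeqENorm w σ p q x < ∞)
    (hy : besovSeqENorm w σ p q y < ∞) : besovSeqENorm w σ p q (x + y) < ∞ := by
  obtain ⟨C, hC, h1⟩ := weightedLpNorm_add_le (ι := Fin m → ℤ) p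
  obtain ⟨D, hD, h2⟩ := weightedLpNorm_add_le (ι := ℕ) q
  obtain ⟨E, hE, h3⟩ := weightedLpNorm_mul_le (ι := ℕ) q C hC
  refine lt_of_le_of_lt (h3 _ _ _ fun ν => ?_) (lt_of_le_of_lt
    (mul_le_mul' (le_refl E) (h2 _ _ _ _ fun ν => le_refl _))
    (ENNReal.mul_lt_top hE.lt_top (ENNReal.mul_lt_top hD.lt_top (ENNReal.add_lt_top.2 ⟨hx, hy⟩))))
  rw [← mul_add, mul_left_comm]
  refine mul_le_mul' (le_refl _) (h1 _ _ _ _ fun k => ?_)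
  exact enorm_add_le _ _

theorem besovSeqENorm_smul_lt_top {m : ℕ} {w : (Fin m → ℝ) → ℝ} {σ : ℝ} {p q : ℝ≥0∞}
    (c : ℂ) {x : ℕ → (Fin m → ℤ) → ℂ} (hx : besovSeqENorm w σ p q x < ∞) :
    besovSeqENorm w σ p q (c • x) < ∞ := by
  obtain ⟨C, hC, h1⟩ := weightedLpNorm_mul_le (ι := Fin m → ℤ) p ‖c‖ₑ enorm_ne_top
  obtain ⟨E, hE, h3⟩ := weightedLpNorm_mul_le (ι := ℕ) q C hC
  refine lt_of_le_of_lt (h3 _ _ _ fun ν => ?_) (ENNReal.mul_lt_top hE.lt_top hx)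
  rw [mul_left_comm]
  refine mul_le_mul' (le_refl _) (h1 _ _ _ fun k => ?_)
  simp

theorem besovSeqENorm_zero {m : ℕ} (w : (Fin m → ℝ) → ℝ) (σ : ℝ) {p q : ℝ≥0∞}
    (hp : 0 < p) (hq : 0 < q) : besovSeqENorm w σ p q 0 = 0 := by
  simp [besovSeqENorm, weightedLpNorm_zero hp.ne', weightedLpNorm_zero hq.ne']

/-- The weighted sequence space `b^σ_{p,q}(w)`, for `0 < p, q ≤ ∞`. -/
def BesovSeq {m : ℕ} (w : (Fin m → ℝ) → ℝ) (σ : ℝ) (p q : ℝ≥0∞) (hp : 0 < p) (hq : 0 < q) :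
    Submodule ℂ (ℕ → (Fin m → ℤ) → ℂ) where
  carrier := {lam | besovSeqENorm w σ p q lam < ∞}
  add_mem' := besovSeqENorm_add_lt_top
  zero_mem' := by
    simp only [Set.mem_ofPred_eq, besovSeqENorm_zero w σ hp hq, ENNReal.zero_lt_top]
  smul_mem' := fun c _ hx => besovSeqENorm_smul_lt_top c hx

/-- The quasi-norm of `b^σ_{p,q}(w)`. -/
instance BesovSeq.instNorm {m : ℕ} (w : (Fin m → ℝ) → ℝ) (σ : ℝ) (p q : ℝ≥0∞)
    (hp : 0 < p) (hq : 0 < q) : Norm (BesovSeq w σ p q hp hq) where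
  norm lam := (besovSeqENorm w σ p q (lam : ℕ → (Fin m → ℤ) → ℂ)).toReal

/-! ### Nuclear operators between quasi-normed spaces

Only the (quasi-)norm function of the spaces enters, so that the definitions apply to Banach and to
quasi-Banach spaces alike. -/

/-- Boundedness of a linear operator with respect to the (quasi-)norms of the two spaces. -/
def IsBoundedOperator {X Y : Type*} [AddCommGroup X] [Module ℂ X] [Norm X]
    [AddCommGroup Y] [Module ℂ Y] [Norm Y] (T : X →ₗ[ℂ] Y) : Prop :=
  ∃ C : ℝ, ∀ x, ‖T x‖ ≤ C * ‖x‖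

/-- The norm `‖a‖ = sup {|a x| : ‖x‖ ≤ 1}` of a (bounded) linear functional. -/
def functionalNorm {X : Type*} [AddCommGroup X] [Module ℂ X] [Norm X] (a : X →ₗ[ℂ] ℂ) : ℝ :=
  sSup {r : ℝ | ∃ x : X, ‖x‖ ≤ 1 ∧ r = ‖a x‖}

/-- A bounded operator `T : X → Y` is nuclear if there are bounded linear functionals `a_j` on `X`
and elements `y_j` of `Y` with `∑ ‖a_j‖ ‖y_j‖ < ∞` and `T x = ∑ a_j(x) y_j` for every `x`, the
series converging in the (quasi-)norm of `Y`. -/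
def IsNuclearOperator {X Y : Type*} [AddCommGroup X] [Module ℂ X] [Norm X]
    [AddCommGroup Y] [Module ℂ Y] [Norm Y] (T : X →ₗ[ℂ] Y) : Prop :=
  IsBoundedOperator T ∧
    ∃ (a : ℕ → X →ₗ[ℂ] ℂ) (y : ℕ → Y), (∀ j, IsBoundedOperator (a j)) ∧
      Summable (fun j => functionalNorm (a j) * ‖y j‖) ∧
      ∀ x, Tendsto (fun N => ‖T x - ∑ j ∈ Finset.range N, a j x • y j‖) atTop (𝓝 0)

/-- The identity is a nuclear operator from the subspace `E` into the subspace `F`: the space `E` is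
contained in `F` and the inclusion is nuclear. -/
def IdIsNuclear {V : Type*} [AddCommGroup V] [Module ℂ V] (E F : Submodule ℂ V)
    [Norm E] [Norm F] : Prop :=
  ∃ h : E ≤ F, IsNuclearOperator (Submodule.inclusion h)

end

/-! Write `t = 1/p₁ - 1/p₂`. The mass `2^{mν} w_γ(Q_{ν,k})` is comparable to `2^e` with `e = ∑ (γ_i
- 1)(size |k_i| - ν)`, where `size` is the binary length. On each level the weight is thus
essentially constant on the block of indices with prescribed sizes, and such a block has exactly
`2^{∑ size |k_i|}` elements. Since `σ₁ - σ₂ = s₁ - s₂ - m t` and `∑ (γ_i - 1) = d - m`, the first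
inequality of the theorem says `t ∑ (γ_i - 1) < σ₁ - σ₂`.

Sufficiency. Expanding in unit vectors is too costly: it would require `t (γ_i - 1) > 1`. On a block
of `N` elements one expands instead in the discrete Fourier basis, whose entries are unimodular.
Jensen's inequality bounds each functional by a multiple of `N^{-1/p₁}`, each vector has norm at
most a multiple of `N^{1/p₂}`, and every term gains the factor `N^{-t}`. With the weight, the term
of index `(ν, k)` is of order `2^{-ν(σ₁ - σ₂ - t ∑ (γ_i - 1))} ∏ 2^{-t γ_i size |k_i|}`. The sum
over `ν` converges by the first inequality and the sum over `k` because `t γ_i > 1`.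
(`BesovSeq.hasSum_blockCoeff`, `BesovSeq.besovSeqENorm_sub_sum_le`, `idIsNuclear_of_lt`.)

Necessity. A nuclear map cannot keep a bounded sequence uniformly biorthogonal
(`IsNuclearOperator.not_biorthogonal`). Normalised unit vectors at `(n, 0)` give the first
inequality, and those along an axis on level `0` give `t > 0`. For `t > 1/γ_i` trace duality is used
(`IsNuclearOperator.exists_trace_le`): composing with a diagonal operator with entries `r_k`, whose
norm Hölder's inequality bounds, gives `∑ r_k ≤ M (∑ r_k^{1/t} 2^e)^t`. If `γ_i ≤ 1/t`, the choice
`r = 1/n` along the `i`-th axis yields `H_N ≤ C H_N^t` for the harmonic sums, impossible since `t <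
1`. Both arguments live on single coordinates or single levels, so `q₁, q₂` never matter. -/

/-! ### Weighted `ℓ_p` inequalities: Minkowski, Hölder, Jensen. -/

theorem weightedLpNorm_mono {ι : Type*} (p : ℝ≥0∞) (W : ι → ℝ≥0∞) {f g : ι → ℝ≥0∞}
    (h : ∀ i, f i ≤ g i) : weightedLpNorm p W f ≤ weightedLpNorm p W g := by
  unfold weightedLpNorm
  split_ifs
  · exact iSup_mono h
  · gcongr with i
    exact h i

theorem weightedLpNorm_const_mul {ι : Type*} {p : ℝ≥0∞} (hp : p ≠ 0) (W : ι → ℝ≥0∞)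
    (c : ℝ≥0∞) (f : ι → ℝ≥0∞) :
    weightedLpNorm p W (fun i => c * f i) = c * weightedLpNorm p W f := by
  unfold weightedLpNorm
  split_ifs with h
  · rw [ENNReal.mul_iSup]
  · have ht : 0 < p.toReal := ENNReal.toReal_pos hp h
    simp_rw [ENNReal.mul_rpow_of_nonneg _ _ ht.le, mul_assoc]
    rw [ENNReal.tsum_mul_left, ENNReal.mul_rpow_of_nonneg _ _ (by positivity), ← ENNReal.rpow_mul,
      mul_one_div_cancel ht.ne', ENNReal.rpow_one]

theorem weightedLpNorm_eq_of_ne_top {ι : Type*} {p : ℝ≥0∞} (hp : p ≠ 0) (hp' : p ≠ ∞)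
    (W f : ι → ℝ≥0∞) : weightedLpNorm p W f =
      (∑' i, (f i * W i ^ (p⁻¹).toReal) ^ p.toReal) ^ (1 / p.toReal) := by
  have ht : 0 < p.toReal := ENNReal.toReal_pos hp hp'
  simp only [weightedLpNorm, hp', if_false]
  simp_rw [ENNReal.mul_rpow_of_nonneg _ _ ht.le, ← ENNReal.rpow_mul, ENNReal.toReal_inv,
    inv_mul_cancel₀ ht.ne', ENNReal.rpow_one]

theorem mul_rpow_le_weightedLpNorm {ι : Type*} {p : ℝ≥0∞} (hp : p ≠ 0) (W f : ι → ℝ≥0∞) (i : ι) :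
    f i * W i ^ (p⁻¹).toReal ≤ weightedLpNorm p W f := by
  by_cases h : p = ∞
  · simpa [weightedLpNorm, h] using le_iSup f i
  · have ht : 0 < p.toReal := ENNReal.toReal_pos hp h
    rw [weightedLpNorm_eq_of_ne_top hp h]
    calc f i * W i ^ (p⁻¹).toReal
        = ((f i * W i ^ (p⁻¹).toReal) ^ p.toReal) ^ (1 / p.toReal) := by
          rw [← ENNReal.rpow_mul, mul_one_div_cancel ht.ne', ENNReal.rpow_one]
      _ ≤ _ := by
          gcongr
          exact ENNReal.le_tsum (f := fun i => (f i * W i ^ (p⁻¹).toReal) ^ p.toReal) i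

theorem weightedLpNorm_eq_of_support {ι : Type*} {p : ℝ≥0∞} (hp : p ≠ 0) (W f : ι → ℝ≥0∞) (i : ι)
    (hf : ∀ j, j ≠ i → f j = 0) :
    weightedLpNorm p W f = f i * W i ^ (p⁻¹).toReal := by
  refine le_antisymm ?_ (mul_rpow_le_weightedLpNorm hp W f i)
  by_cases h : p = ∞
  · simp only [weightedLpNorm, h, if_true, ENNReal.inv_top, ENNReal.toReal_zero, ENNReal.rpow_zero,
      mul_one]
    refine iSup_le fun j => ?_
    by_cases hj : j = i
    · rw [hj]
    · simp [hf j hj]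
  · have ht : 0 < p.toReal := ENNReal.toReal_pos hp h
    rw [weightedLpNorm_eq_of_ne_top hp h, tsum_eq_single i, ← ENNReal.rpow_mul,
      mul_one_div_cancel ht.ne', ENNReal.rpow_one]
    intro j hj
    rw [hf j hj, zero_mul, ENNReal.zero_rpow_of_pos ht]

/-- Minkowski's inequality for infinite sums: the finite inequality, with limits taken first over
finite sets of summands and then over finite sets of coordinates. -/
theorem ennreal_Lp_tsum_le {ι κ : Type*} {t : ℝ} (ht : 1 ≤ t) (g : κ → ι → ℝ≥0∞) :
    (∑' i, (∑' j, g j i) ^ t) ^ (1 / t) ≤ ∑' j, (∑' i, g j i ^ t) ^ (1 / t) := by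
  classical
  have t0 : 0 < t := by linarith
  have hfin : ∀ (F : Finset κ) (s : Finset ι),
      (∑ i ∈ s, (∑ j ∈ F, g j i) ^ t) ^ (1 / t) ≤ ∑ j ∈ F, (∑ i ∈ s, g j i ^ t) ^ (1 / t) := by
    intro F s
    induction F using Finset.induction_on with
    | empty => simp [t0]
    | insert a F ha ih =>
      simp_rw [Finset.sum_insert ha]
      exact (ENNReal.Lp_add_le s _ _ ht).trans (by gcongr)
  rw [one_div, ENNReal.rpow_inv_le_iff t0]
  refine ENNReal.summable.tsum_le_of_sum_le fun s => ?_
  have hlim : Tendsto (fun F : Finset κ => ∑ i ∈ s, (∑ j ∈ F, g j i) ^ t) atTop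
      (𝓝 (∑ i ∈ s, (∑' j, g j i) ^ t)) :=
    tendsto_finsetSum _ fun i _ =>
      (ENNReal.continuous_rpow_const.tendsto _).comp ENNReal.summable.hasSum
  refine le_of_tendsto' hlim fun F => ?_
  rw [← ENNReal.rpow_inv_le_iff t0, ← one_div]
  refine (hfin F s).trans ?_
  refine (Finset.sum_le_sum fun j _ => ?_).trans (ENNReal.sum_le_tsum F)
  gcongr
  exact ENNReal.sum_le_tsum s

theorem weightedLpNorm_tsum_le {ι κ : Type*} {p : ℝ≥0∞} (hp : 1 ≤ p) (W : ι → ℝ≥0∞)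
    (g : κ → ι → ℝ≥0∞) :
    weightedLpNorm p W (fun i => ∑' j, g j i) ≤ ∑' j, weightedLpNorm p W (g j) := by
  by_cases h : p = ∞
  · simp only [weightedLpNorm, h, if_true]
    exact iSup_le fun i => ENNReal.tsum_le_tsum fun j => le_iSup (g j) i
  · have h0 : p ≠ 0 := (zero_lt_one.trans_le hp).ne'
    simp_rw [weightedLpNorm_eq_of_ne_top h0 h, ← ENNReal.tsum_mul_right]
    refine ennreal_Lp_tsum_le ?_ _
    simpa using ENNReal.toReal_mono h hp

/-- Hölder's inequality: the weight is split as `W^{1/p₁} = W^t W^{1/p₂}` and absorbed into the two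
factors. It bounds diagonal operators in the trace argument. -/
theorem weightedLpNorm_mul_le_mul {ι : Type*} {p₁ p₂ : ℝ≥0∞} (hp₁ : p₁ ≠ 0) (hp₂ : p₂ ≠ 0)
    {t : ℝ} (ht : 0 < t) (h : (p₁⁻¹).toReal = t + (p₂⁻¹).toReal) (W r f : ι → ℝ≥0∞) :
    weightedLpNorm p₁ W (fun i => r i * f i) ≤
      (∑' i, r i ^ (1 / t) * W i) ^ t * weightedLpNorm p₂ W f := by
  have h1 : p₁ ≠ ∞ := by
    rintro rfl
    have : 0 ≤ (p₂⁻¹).toReal := ENNReal.toReal_nonneg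
    rw [ENNReal.inv_top, ENNReal.toReal_zero] at h
    linarith
  have ht1 : 0 < p₁.toReal := ENNReal.toReal_pos hp₁ h1
  by_cases h2 : p₂ = ∞
  · simp only [h2, ENNReal.inv_top, ENNReal.toReal_zero, add_zero, ENNReal.toReal_inv] at h
    simp only [weightedLpNorm, h2, h1, if_true, if_false]
    have e1 : p₁.toReal = 1 / t := by rw [← h]; simp
    rw [e1, one_div_one_div]
    have : ∑' i, (r i * f i) ^ (1 / t) * W i ≤
        (∑' i, r i ^ (1 / t) * W i) * (⨆ i, f i) ^ (1 / t) := by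
      rw [← ENNReal.tsum_mul_right]
      refine ENNReal.tsum_le_tsum fun i => ?_
      rw [ENNReal.mul_rpow_of_nonneg _ _ (by positivity), mul_right_comm]
      gcongr
      exact le_iSup f i
    refine (ENNReal.rpow_le_rpow this ht.le).trans ?_
    rw [ENNReal.mul_rpow_of_nonneg _ _ ht.le, ← ENNReal.rpow_mul, one_div_mul_cancel ht.ne',
      ENNReal.rpow_one]
  · have ht2 : 0 < p₂.toReal := ENNReal.toReal_pos hp₂ h2
    rw [weightedLpNorm_eq_of_ne_top hp₁ h1, weightedLpNorm_eq_of_ne_top hp₂ h2]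
    -- The sums become integrals for counting measure, with every function measurable.
    let _ : MeasurableSpace ι := ⊤
    rw [ENNReal.toReal_inv, ENNReal.toReal_inv] at h
    have hlt : p₁.toReal < 1 / t := by
      rw [lt_one_div ht1 ht, one_div, h]
      have := inv_pos.2 ht2
      linarith
    have := ENNReal.lintegral_Lp_mul_le_Lq_mul_Lr (p := p₁.toReal) (q := 1 / t) (r := p₂.toReal)
      ht1 hlt (by rw [one_div, h, one_div_one_div, one_div]) Measure.count
      (f := fun i => r i * W i ^ t) (g := fun i => f i * W i ^ (p₂⁻¹).toReal)
      (Measurable.aemeasurable fun _ _ => trivial) (Measurable.aemeasurable fun _ _ => trivial)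
    simp only [lintegral_count, Pi.mul_apply] at this
    rw [one_div_one_div] at this
    convert! this using 3 with i
    · congr 1 with i
      rw [ENNReal.toReal_inv, ENNReal.toReal_inv, h, ENNReal.rpow_add_of_nonneg _ _ ht.le (by positivity)]
      ring_nf
    · congr 1 with i
      rw [ENNReal.mul_rpow_of_nonneg _ _ (by positivity), ← ENNReal.rpow_mul,
        mul_one_div_cancel ht.ne', ENNReal.rpow_one]

theorem weightedLpNorm_le_of_subset {ι : Type*} {p : ℝ≥0∞} (hp : p ≠ 0) {W f : ι → ℝ≥0∞}
    (S : Finset ι) {B : ℝ≥0∞} (hf : ∀ i, f i ≤ 1) (hS : ∀ i ∉ S, f i = 0)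
    (hW : ∀ i ∈ S, W i ≤ B) :
    weightedLpNorm p W f ≤ (S.card * B) ^ (p⁻¹).toReal := by
  by_cases h : p = ∞
  · simp [weightedLpNorm, h, hf]
  · have ht : 0 < p.toReal := ENNReal.toReal_pos hp h
    rw [ENNReal.toReal_inv, ← one_div]
    simp only [weightedLpNorm, h, if_false]
    gcongr
    rw [tsum_eq_sum (s := S) fun i hi => by rw [hS i hi, ENNReal.zero_rpow_of_pos ht, zero_mul],
      ← nsmul_eq_mul]
    refine Finset.sum_le_card_nsmul _ _ _ fun i hi => ?_
    calc f i ^ p.toReal * W i ≤ 1 ^ p.toReal * B := by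
          gcongr
          exacts [hf i, hW i hi]
      _ = B := by simp

/-- Jensen's inequality for the uniform probability on `S`. The gain `(#S · c)^{-1/p}` is what makes
block functionals small. -/
theorem sum_le_weightedLpNorm {ι : Type*} {p : ℝ≥0∞} (hp : 1 ≤ p) {W : ι → ℝ≥0∞}
    (f : ι → ℝ≥0∞) (S : Finset ι) (hS : S.Nonempty) {c : ℝ≥0∞} (hc : c ≠ 0) (hc' : c ≠ ∞)
    (hW : ∀ i ∈ S, c ≤ W i) :
    (S.card : ℝ≥0∞)⁻¹ * ∑ i ∈ S, f i ≤
      (S.card * c) ^ (-(p⁻¹).toReal) * weightedLpNorm p W f := by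
  have n0 : (S.card : ℝ≥0∞) ≠ 0 := by simpa using hS.ne_empty
  have n1 : (S.card : ℝ≥0∞) ≠ ∞ := by simp
  by_cases h : p = ∞
  · simp only [weightedLpNorm, h, if_true, ENNReal.inv_top, ENNReal.toReal_zero, neg_zero,
      ENNReal.rpow_zero, one_mul]
    calc (S.card : ℝ≥0∞)⁻¹ * ∑ i ∈ S, f i ≤ (S.card : ℝ≥0∞)⁻¹ * (S.card • ⨆ i, f i) := by
          gcongr
          exact Finset.sum_le_card_nsmul _ _ _ fun i _ => le_iSup f i
      _ = _ := by rw [nsmul_eq_mul, ← mul_assoc, ENNReal.inv_mul_cancel n0 n1, one_mul]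
  · have t1 : 1 ≤ p.toReal := by simpa using ENNReal.toReal_mono h hp
    have ht : 0 < p.toReal := by linarith
    simp only [weightedLpNorm, h, if_false, ENNReal.toReal_inv]
    rw [ENNReal.rpow_neg, ← ENNReal.inv_rpow, one_div,
      ← ENNReal.mul_rpow_of_nonneg _ _ (by positivity), ENNReal.le_rpow_inv_iff ht, Finset.mul_sum]
    refine (ENNReal.rpow_arith_mean_le_arith_mean_rpow S (fun _ => (S.card : ℝ≥0∞)⁻¹) f ?_ t1).trans
      ?_
    · rw [Finset.sum_const, nsmul_eq_mul, ENNReal.mul_inv_cancel n0 n1]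
    · rw [ENNReal.mul_inv (Or.inl n0) (Or.inl n1), mul_assoc, ← ENNReal.tsum_mul_left,
        ← Finset.mul_sum]
      gcongr
      refine (Finset.sum_le_sum fun i hi => ?_).trans (ENNReal.sum_le_tsum S)
      calc f i ^ p.toReal = c⁻¹ * (f i ^ p.toReal * c) := by
            rw [mul_left_comm, ENNReal.inv_mul_cancel hc hc', mul_one]
        _ ≤ _ := by
            gcongr
            exact hW i hi

/-! ### Two-sided estimates for the mass of dyadic cubes. -/

/-- The exponent `e` for which `2 ^ {mν} w_γ(Q_{ν,k})` is comparable to `2 ^ e`. -/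
noncomputable def weightExponent {m : ℕ} (γ : Fin m → ℕ) (ν : ℕ) (k : Fin m → ℤ) : ℝ :=
  ∑ i, ((γ i : ℝ) - 1) * ((Nat.size (k i).natAbs : ℝ) - ν)

theorem abs_add_one_le_two_pow_size (k : ℤ) : |(k : ℝ)| + 1 ≤ 2 ^ Nat.size k.natAbs := by
  have h := Nat.lt_size_self k.natAbs
  rw [← Int.cast_abs, ← Int.natCast_natAbs, Int.cast_natCast]
  exact_mod_cast h

theorem two_pow_size_le (k : ℤ) : (2 : ℝ) ^ Nat.size k.natAbs ≤ 2 * |(k : ℝ)| + 1 := by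
  by_cases hk : k = 0
  · simp [hk]
  · have h0 : 0 < Nat.size k.natAbs := Nat.size_pos.2 (by omega)
    have h : 2 ^ (Nat.size k.natAbs - 1) ≤ k.natAbs := Nat.lt_size.1 (by omega)
    have h2 : 2 ^ Nat.size k.natAbs ≤ 2 * k.natAbs := by
      calc 2 ^ Nat.size k.natAbs = 2 * 2 ^ (Nat.size k.natAbs - 1) := by
            rw [← pow_succ']; congr 1; omega
        _ ≤ _ := by gcongr
    have h3 : (2 : ℝ) ^ Nat.size k.natAbs ≤ 2 * |(k : ℝ)| := by
      rw [← Int.cast_abs, ← Int.natCast_natAbs, Int.cast_natCast]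
      exact_mod_cast h2
    linarith

theorem two_pow_mul_eq_rpow_weightExponent {m : ℕ} (γ : Fin m → ℕ) (hγ : ∀ i, 1 ≤ γ i) (ν : ℕ)
    (k : Fin m → ℤ) :
    ∏ i, ((2 : ℝ) ^ (-(ν : ℤ)) * 2 ^ Nat.size (k i).natAbs) ^ (γ i - 1) =
      2 ^ weightExponent γ ν k := by
  rw [weightExponent, Real.rpow_sum_of_pos two_pos]
  refine Finset.prod_congr rfl fun i _ => ?_
  have hc : ((γ i - 1 : ℕ) : ℝ) = (γ i : ℝ) - 1 := by simp [hγ i]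
  rw [← hc, mul_comm ((γ i - 1 : ℕ) : ℝ), Real.rpow_mul two_pos.le, Real.rpow_natCast,
    sub_eq_add_neg, add_comm, Real.rpow_add two_pos, Real.rpow_natCast, ← Real.rpow_intCast,
    Int.cast_neg, Int.cast_natCast]

theorem ofReal_two_rpow (x : ℝ) : ENNReal.ofReal (2 ^ x) = 2 ^ x := by
  rw [← ENNReal.ofReal_rpow_of_pos two_pos, ENNReal.ofReal_ofNat]

theorem two_pow_mul_ofReal_prod {m : ℕ} (ν : ℕ) :
    (2 : ℝ≥0∞) ^ (m * ν) * ∏ _i : Fin m, ENNReal.ofReal ((2 : ℝ) ^ (-(ν : ℤ))) = 1 := by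
  rw [Finset.prod_const, Finset.card_univ, Fintype.card_fin, mul_comm m ν, pow_mul, ← mul_pow,
    zpow_neg, zpow_natCast, ENNReal.ofReal_inv_of_pos (by positivity),
    ENNReal.ofReal_pow two_pos.le, ENNReal.ofReal_ofNat,
    ENNReal.mul_inv_cancel (by positivity) (by simp), one_pow]

theorem weightMass_dyadicCube_le {m : ℕ} (γ : Fin m → ℕ) (hγ : ∀ i, 1 ≤ γ i) (ν : ℕ)
    (k : Fin m → ℤ) :
    2 ^ (m * ν) * weightMass (blockWeight γ) (dyadicCube ν k) ≤
      (2 : ℝ≥0∞) ^ weightExponent γ ν k := by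
  set h : ℝ := (2 : ℝ) ^ (-(ν : ℤ)) with hh
  have h0 : 0 < h := by positivity
  have hQ : dyadicCube ν k = Set.Icc (fun i => h * k i - h / 2) (fun i => h * k i + h / 2) := by
    ext x
    simp only [dyadicCube, Set.mem_ofPred_eq, abs_le, Set.mem_Icc, Pi.le_def, ← forall_and, ← hh]
    refine forall_congr' fun i => ?_
    constructor <;> rintro ⟨h1, h2⟩ <;> constructor <;> linarith
  have hvol : volume (dyadicCube ν k) = ∏ _i : Fin m, ENNReal.ofReal h := by
    rw [hQ, Real.volume_Icc_pi]
    refine Finset.prod_congr rfl fun i _ => ?_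
    congr 1; ring
  have hbd : ∀ x ∈ dyadicCube ν k, ENNReal.ofReal (blockWeight γ x) ≤
      2 ^ weightExponent γ ν k := by
    intro x hx
    rw [← ofReal_two_rpow, ← two_pow_mul_eq_rpow_weightExponent γ hγ]
    refine ENNReal.ofReal_le_ofReal ?_
    unfold blockWeight
    gcongr with i _
    have h1 := hx i
    rw [← hh] at h1 ⊢
    have h2 := abs_add_one_le_two_pow_size (k i)
    calc |x i| = |(x i - h * k i) + h * k i| := by ring_nf
      _ ≤ |x i - h * k i| + |h * k i| := abs_add_le _ _
      _ ≤ h / 2 + h * |(k i : ℝ)| := by rw [abs_mul, abs_of_pos h0]; gcongr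
      _ ≤ h * (|(k i : ℝ)| + 1) := by linarith
      _ ≤ _ := by gcongr
  calc 2 ^ (m * ν) * weightMass (blockWeight γ) (dyadicCube ν k)
      ≤ 2 ^ (m * ν) * ∫⁻ _ in dyadicCube ν k, 2 ^ weightExponent γ ν k := by
        gcongr
        refine setLIntegral_mono' ?_ hbd
        rw [hQ]; exact measurableSet_Icc
    _ = 2 ^ weightExponent γ ν k * (2 ^ (m * ν) * ∏ _i : Fin m, ENNReal.ofReal h) := by
        rw [setLIntegral_const, hvol]; ring
    _ = _ := by rw [two_pow_mul_ofReal_prod, mul_one]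

theorem le_weightMass_dyadicCube {m : ℕ} (γ : Fin m → ℕ) (hγ : ∀ i, 1 ≤ γ i) (ν : ℕ)
    (k : Fin m → ℤ) :
    (2 : ℝ≥0∞) ^ (weightExponent γ ν k - 2 * ∑ i, (γ i : ℝ)) ≤
    2 ^ (m * ν) * weightMass (blockWeight γ) (dyadicCube ν k) := by
  set h : ℝ := (2 : ℝ) ^ (-(ν : ℤ)) with hh
  have h0 : 0 < h := by positivity
  -- A subcube of side `h / 4` on the side of `Q_{ν,k}` away from the coordinate hyperplanes, where
  -- `|x_i| ≥ h (|k_i| + 1/4)`. The weight loses at most `4^{γ_i - 1}` and the volume `4` per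
  -- coordinate, together `2^{2 ∑ γ_i}`.
  set a : Fin m → ℝ := fun i => h * (if 0 ≤ k i then (k i : ℝ) + 1 / 4 else (k i : ℝ) - 1 / 2)
    with ha
  set R : Set (Fin m → ℝ) := Set.Icc a (fun i => a i + h / 4) with hR
  have hsub : R ⊆ dyadicCube ν k := by
    rintro x ⟨hx1, hx2⟩ i
    have h1 := hx1 i
    have h2 := hx2 i
    simp only [ha] at h1 h2
    rw [← hh, abs_le]
    split_ifs at h1 h2 <;> constructor <;> linarith
  have hbd : ∀ x ∈ R, (2 : ℝ≥0∞) ^ (weightExponent γ ν k - 2 * (∑ i, ((γ i : ℝ) - 1))) ≤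
      ENNReal.ofReal (blockWeight γ x) := by
    rintro x ⟨hx1, hx2⟩
    rw [← ofReal_two_rpow]
    refine ENNReal.ofReal_le_ofReal ?_
    have e1 : (2 : ℝ) ^ (weightExponent γ ν k - 2 * ∑ i, ((γ i : ℝ) - 1)) =
        ∏ i, (h * 2 ^ Nat.size (k i).natAbs / 4) ^ (γ i - 1) := by
      simp_rw [div_pow, Finset.prod_div_distrib]
      rw [two_pow_mul_eq_rpow_weightExponent γ hγ, Real.rpow_sub two_pos,
        Real.rpow_mul two_pos.le, Real.rpow_sum_of_pos (by positivity)]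
      congr 1
      refine Finset.prod_congr rfl fun i _ => ?_
      have hc : ((γ i - 1 : ℕ) : ℝ) = (γ i : ℝ) - 1 := by simp [hγ i]
      rw [← hc, Real.rpow_natCast]
      norm_num
    rw [e1]
    unfold blockWeight
    gcongr with i _
    have h1 := hx1 i
    have h2 := hx2 i
    have h3 := two_pow_size_le (k i)
    have h4 : h * 2 ^ Nat.size (k i).natAbs / 4 ≤ h * (|(k i : ℝ)| + 1 / 4) := by
      rw [mul_div_assoc]
      gcongr
      have := abs_nonneg (k i : ℝ)
      linarith
    refine h4.trans ?_
    simp only [ha] at h1 h2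
    split_ifs at h1 h2 with hk
    · rw [abs_of_nonneg (by exact_mod_cast hk : (0 : ℝ) ≤ k i)]
      exact h1.trans (le_abs_self _)
    · rw [abs_of_neg (by exact_mod_cast not_le.1 hk : (k i : ℝ) < 0)]
      refine le_trans ?_ (neg_le_abs _)
      linarith
  have hvol : volume R = ∏ _i : Fin m, ENNReal.ofReal h * 2 ^ (-2 : ℝ) := by
    rw [hR, Real.volume_Icc_pi]
    refine Finset.prod_congr rfl fun i _ => ?_
    rw [← ofReal_two_rpow, ← ENNReal.ofReal_mul h0.le]
    congr 1
    rw [Real.rpow_neg two_pos.le]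
    norm_num
    ring
  calc (2 : ℝ≥0∞) ^ (weightExponent γ ν k - 2 * ∑ i, (γ i : ℝ))
      = 2 ^ (weightExponent γ ν k - 2 * ∑ i, ((γ i : ℝ) - 1)) *
        (2 ^ (m * ν) * volume R) := by
        rw [hvol, Finset.prod_mul_distrib, ← mul_assoc (2 ^ (m * ν)), two_pow_mul_ofReal_prod,
          one_mul, Finset.prod_const, Finset.card_univ, Fintype.card_fin, ← ENNReal.rpow_natCast,
          ← ENNReal.rpow_mul, ← ENNReal.rpow_add _ _ two_ne_zero (by simp)]
        congr 1
        rw [Finset.sum_sub_distrib]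
        simp
        ring
    _ = 2 ^ (m * ν) * ∫⁻ _ in R, 2 ^ (weightExponent γ ν k - 2 * ∑ i, ((γ i : ℝ) - 1)) := by
        rw [setLIntegral_const]; ring
    _ ≤ 2 ^ (m * ν) * ∫⁻ x in R, ENNReal.ofReal (blockWeight γ x) := by
        exact mul_le_mul' le_rfl (setLIntegral_mono' measurableSet_Icc hbd)
    _ ≤ _ := by
        unfold weightMass
        gcongr

/-! ### Nuclear operators without a triangle inequality. -/

section Abstract

variable {X Y : Type*} [AddCommGroup X] [Module ℂ X] [Norm X]
  [AddCommGroup Y] [Module ℂ Y] [Norm Y]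

theorem functionalNorm_nonneg (a : X →ₗ[ℂ] ℂ) : 0 ≤ functionalNorm a :=
  Real.sSup_nonneg (by rintro r ⟨x, -, rfl⟩; exact norm_nonneg _)

theorem functionalNorm_le {a : X →ₗ[ℂ] ℂ} {C : ℝ} (hC : 0 ≤ C)
    (h : ∀ x, ‖a x‖ ≤ C * ‖x‖) : functionalNorm a ≤ C := by
  refine Real.sSup_le ?_ hC
  rintro r ⟨x, hx, rfl⟩
  exact (h x).trans (mul_le_of_le_one_right hC hx)

theorem norm_le_functionalNorm_mul (hX : ∀ (c : ℂ) (x : X), ‖c • x‖ = ‖c‖ * ‖x‖)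
    (hX0 : ∀ x : X, 0 ≤ ‖x‖) {a : X →ₗ[ℂ] ℂ} (ha : IsBoundedOperator a) (x : X) :
    ‖a x‖ ≤ functionalNorm a * ‖x‖ := by
  obtain ⟨C, hC⟩ := ha
  -- A vector of norm zero cannot be normalised; there boundedness itself gives `a x = 0`.
  rcases (hX0 x).eq_or_lt with h | h
  · have := hC x
    rw [← h, mul_zero] at this ⊢
    exact this
  · have hb : BddAbove {r : ℝ | ∃ x : X, ‖x‖ ≤ 1 ∧ r = ‖a x‖} := by
      refine ⟨|C|, ?_⟩
      rintro r ⟨z, hz, rfl⟩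
      calc ‖a z‖ ≤ C * ‖z‖ := hC z
        _ ≤ |C| * ‖z‖ := mul_le_mul_of_nonneg_right (le_abs_self C) (hX0 z)
        _ ≤ |C| := mul_le_of_le_one_right (abs_nonneg C) hz
    have h1 : ‖(((‖x‖⁻¹ : ℝ) : ℂ)) • x‖ ≤ 1 := by
      rw [hX, Complex.norm_real, norm_inv, Real.norm_of_nonneg h.le, inv_mul_cancel₀ h.ne']
    have h2 : ‖a ((((‖x‖⁻¹ : ℝ) : ℂ)) • x)‖ ≤ functionalNorm a := le_csSup hb ⟨_, h1, rfl⟩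
    rw [map_smul, norm_smul, Complex.norm_real, norm_inv, Real.norm_of_nonneg h.le,
      inv_mul_le_iff₀ h, mul_comm] at h2
    exact h2

/-- A bounded functional turns the nuclear expansion into an absolutely convergent scalar series, so
later arguments need no triangle inequality in `Y`. -/
theorem hasSum_coordinate {T : X →ₗ[ℂ] Y} (hX : ∀ (c : ℂ) (x : X), ‖c • x‖ = ‖c‖ * ‖x‖)
    (hX0 : ∀ x : X, 0 ≤ ‖x‖) {a : ℕ → X →ₗ[ℂ] ℂ} {y : ℕ → Y}
    (ha : ∀ j, IsBoundedOperator (a j))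
    (hs : Summable (fun j => functionalNorm (a j) * ‖y j‖)) {x : X}
    (hT : Tendsto (fun N => ‖T x - ∑ j ∈ Finset.range N, a j x • y j‖) atTop (𝓝 0))
    {f : Y →ₗ[ℂ] ℂ} {K : ℝ} (hf : ∀ z, ‖f z‖ ≤ K * ‖z‖) :
    HasSum (fun j => a j x * f (y j)) (f (T x)) := by
  have hsum : Summable (fun j => a j x * f (y j)) := by
    refine Summable.of_norm_bounded (hs.mul_right (‖x‖ * K)) fun j => ?_
    rw [norm_mul]
    calc ‖a j x‖ * ‖f (y j)‖ ≤ (functionalNorm (a j) * ‖x‖) * (K * ‖y j‖) :=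
          mul_le_mul (norm_le_functionalNorm_mul hX hX0 (ha j) x) (hf _) (norm_nonneg _)
            (mul_nonneg (functionalNorm_nonneg _) (hX0 x))
      _ = _ := by ring
  rw [hsum.hasSum_iff_tendsto_nat, tendsto_iff_norm_sub_tendsto_zero]
  refine squeeze_zero (fun _ => norm_nonneg _) (fun N => ?_) (by simpa using hT.const_mul K)
  have : f (T x - ∑ j ∈ Finset.range N, a j x • y j) =
      f (T x) - ∑ j ∈ Finset.range N, a j x * f (y j) := by
    rw [map_sub, map_sum]
    simp
  rw [norm_sub_rev, ← this]
  exact hf _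

/-- A nuclear operator does not send a bounded sequence to one which is uniformly separated by a
biorthogonal bounded sequence of functionals. -/
theorem IsNuclearOperator.not_biorthogonal {T : X →ₗ[ℂ] Y} (hT : IsNuclearOperator T)
    (hX : ∀ (c : ℂ) (x : X), ‖c • x‖ = ‖c‖ * ‖x‖) (hX0 : ∀ x : X, 0 ≤ ‖x‖) {x : ℕ → X} {f : ℕ → Y →ₗ[ℂ] ℂ} {K : ℝ}
    (hx : ∀ n, ‖x n‖ ≤ 1) (hf : ∀ n z, ‖f n z‖ ≤ K * ‖z‖)
    (h0 : ∀ n n', n ≠ n' → f n (T (x n')) = 0) (h1 : ∀ n, f n (T (x n)) = 1) : False := by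
  obtain ⟨-, a, y, ha, hs, hlim⟩ := hT
  have hsum : ∀ n n', HasSum (fun j => a j (x n) * f n' (y j)) (f n' (T (x n))) := fun n n' =>
    hasSum_coordinate hX hX0 ha hs (hlim _) (hf n')
  have hax : ∀ j n, ‖a j (x n)‖ ≤ functionalNorm (a j) := fun j n =>
    (norm_le_functionalNorm_mul hX hX0 (ha j) _).trans
      (mul_le_of_le_one_right (functionalNorm_nonneg _) (hx n))
  -- A nonprincipal ultrafilter provides limits for all `j` at once, replacing a diagonal
  -- subsequence.
  have hlimA : ∀ j, ∃ A : ℂ, Tendsto (fun n => a j (x n)) (hyperfilter ℕ) (𝓝 A) := by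
    intro j
    obtain ⟨A, -, hA⟩ := (isCompact_closedBall (0 : ℂ) (functionalNorm (a j))).ultrafilter_le_nhds
      ((hyperfilter ℕ).map fun n => a j (x n)) (tendsto_principal.2
        (Eventually.of_forall fun n => by simpa using hax j n))
    exact ⟨A, hA⟩
  choose A hA using hlimA
  have hAn : ∀ j, ‖A j‖ ≤ functionalNorm (a j) := fun j =>
    le_of_tendsto (hA j).norm (Eventually.of_forall (hax j))
  -- For fixed `n'` the trace `f n' (T (x n))` vanishes for all `n ≠ n'`, hence so does its limit.
  have hzero : ∀ n', ∑' j, A j * f n' (y j) = 0 := by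
    intro n'
    have ht : Tendsto (fun n => ∑' j, a j (x n) * f n' (y j)) (hyperfilter ℕ)
        (𝓝 (∑' j, A j * f n' (y j))) := by
      refine tendsto_tsum_of_dominated_convergence (hs.mul_left K)
        (fun j => (hA j).mul_const _) (Eventually.of_forall fun n j => ?_)
      rw [norm_mul]
      calc ‖a j (x n)‖ * ‖f n' (y j)‖ ≤ functionalNorm (a j) * (K * ‖y j‖) :=
            mul_le_mul (hax j n) (hf _ _) (norm_nonneg _) (functionalNorm_nonneg _)
        _ = _ := by ring
    refine tendsto_nhds_unique ht (tendsto_const_nhds.congr' ?_)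
    have : ∀ᶠ n in (hyperfilter ℕ : Filter ℕ), n ≠ n' := by
      refine hyperfilter_le_cofinite ?_
      simp
    filter_upwards [this] with n hn
    rw [(hsum n n').tsum_eq, h0 n' n hn.symm]
  have hAs : ∀ n', Summable fun j => A j * f n' (y j) := by
    intro n'
    refine Summable.of_norm_bounded (hs.mul_left K) fun j => ?_
    rw [norm_mul]
    calc ‖A j‖ * ‖f n' (y j)‖ ≤ functionalNorm (a j) * (K * ‖y j‖) :=
          mul_le_mul (hAn j) (hf _ _) (norm_nonneg _) (functionalNorm_nonneg _)
      _ = _ := by ring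
  have hone : ∀ n, ∑' j, (a j (x n) - A j) * f n (y j) = 1 := by
    intro n
    simp_rw [sub_mul]
    rw [(hsum n n).summable.tsum_sub (hAs n), hzero, (hsum n n).tsum_eq, h1, sub_zero]
  -- Dominated convergence sends these sums to `0`, although each equals `1`; the uniform bound `K`
  -- on the `f n` is essential here.
  have ht : Tendsto (fun n => ∑' j, (a j (x n) - A j) * f n (y j)) (hyperfilter ℕ)
      (𝓝 (∑' _ : ℕ, 0)) := by
    refine tendsto_tsum_of_dominated_convergence (hs.mul_left (2 * K)) (fun j => ?_)
      (Eventually.of_forall fun n j => ?_)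
    · have h2 : Tendsto (fun n => ‖a j (x n) - A j‖ * (K * ‖y j‖)) (hyperfilter ℕ) (𝓝 0) := by
        have := (tendsto_iff_norm_sub_tendsto_zero.1 (hA j)).mul_const (K * ‖y j‖)
        simpa using this
      refine squeeze_zero_norm (fun n => ?_) h2
      rw [norm_mul]
      gcongr
      exact hf _ _
    · rw [norm_mul]
      have h3 : ‖a j (x n) - A j‖ ≤ 2 * functionalNorm (a j) :=
        (norm_sub_le _ _).trans (by linarith [hax j n, hAn j])
      calc ‖a j (x n) - A j‖ * ‖f n (y j)‖ ≤ (2 * functionalNorm (a j)) * (K * ‖y j‖) :=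
            mul_le_mul h3 (hf _ _) (norm_nonneg _) (by linarith [functionalNorm_nonneg (a j)])
        _ = _ := by ring
  simp_rw [hone, tsum_zero] at ht
  exact one_ne_zero (tendsto_nhds_unique tendsto_const_nhds ht)

/-- Trace duality: composing a nuclear operator with a finite rank operator bounds the trace. -/
theorem IsNuclearOperator.exists_trace_le {T : X →ₗ[ℂ] Y} (hT : IsNuclearOperator T)
    (hX : ∀ (c : ℂ) (x : X), ‖c • x‖ = ‖c‖ * ‖x‖) (hX0 : ∀ x : X, 0 ≤ ‖x‖) :
    ∃ M : ℝ, ∀ (ι : Type) (s : Finset ι) (x : ι → X) (f : ι → Y →ₗ[ℂ] ℂ) (K : ℝ),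
      (∀ i, ∃ C, ∀ z, ‖f i z‖ ≤ C * ‖z‖) →
      (∀ z, ‖∑ i ∈ s, f i z • x i‖ ≤ K * ‖z‖) → ‖∑ i ∈ s, f i (T (x i))‖ ≤ M * K := by
  obtain ⟨-, a, y, ha, hs, hlim⟩ := hT
  refine ⟨∑' j, functionalNorm (a j) * ‖y j‖, fun ι s x f K hf hR => ?_⟩
  have hsum : HasSum (fun j => a j (∑ i ∈ s, f i (y j) • x i)) (∑ i ∈ s, f i (T (x i))) := by
    have : ∀ i ∈ s, HasSum (fun j => a j (x i) * f i (y j)) (f i (T (x i))) := fun i _ => by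
      obtain ⟨C, hfC⟩ := hf i
      exact hasSum_coordinate hX hX0 ha hs (hlim _) hfC
    refine (hasSum_sum this).congr_fun fun j => ?_
    simp [map_sum, mul_comm]
  rw [← hsum.tsum_eq]
  refine tsum_of_norm_bounded (hs.hasSum.mul_right K) fun j => ?_
  calc ‖a j (∑ i ∈ s, f i (y j) • x i)‖
      ≤ functionalNorm (a j) * ‖∑ i ∈ s, f i (y j) • x i‖ :=
        norm_le_functionalNorm_mul hX hX0 (ha j) _
    _ ≤ functionalNorm (a j) * (K * ‖y j‖) :=
        mul_le_mul_of_nonneg_left (hR _) (functionalNorm_nonneg _)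
    _ = _ := by ring

end Abstract

/-! ### The sequence spaces: homogeneity, unit vectors and coordinate functionals. -/

section Besov

variable {m : ℕ} {w : (Fin m → ℝ) → ℝ} {σ : ℝ} {p q : ℝ≥0∞}

theorem besovSeqENorm_smul (hp : p ≠ 0) (hq : q ≠ 0) (c : ℂ) (x : ℕ → (Fin m → ℤ) → ℂ) :
    besovSeqENorm w σ p q (c • x) = ‖c‖ₑ * besovSeqENorm w σ p q x := by
  unfold besovSeqENorm
  simp only [Pi.smul_apply, smul_eq_mul, enorm_mul]
  simp_rw [weightedLpNorm_const_mul hp, mul_left_comm _ ‖c‖ₑ, weightedLpNorm_const_mul hq]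

theorem level_le_besovSeqENorm (hq : q ≠ 0) (x : ℕ → (Fin m → ℤ) → ℂ) (ν : ℕ) :
    (2 : ℝ≥0∞) ^ ((ν : ℝ) * σ) *
      weightedLpNorm p (fun k => 2 ^ (m * ν) * weightMass w (dyadicCube ν k)) (fun k => ‖x ν k‖ₑ) ≤
    besovSeqENorm w σ p q x := by
  have := mul_rpow_le_weightedLpNorm hq (fun _ : ℕ => 1) (fun ν =>
    (2 : ℝ≥0∞) ^ ((ν : ℝ) * σ) *
      weightedLpNorm p (fun k => 2 ^ (m * ν) * weightMass w (dyadicCube ν k)) fun k => ‖x ν k‖ₑ) ν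
  simpa only [ENNReal.one_rpow, mul_one, besovSeqENorm] using this

theorem coordinate_le_besovSeqENorm (hp : p ≠ 0) (hq : q ≠ 0) (x : ℕ → (Fin m → ℤ) → ℂ) (ν : ℕ)
    (k : Fin m → ℤ) :
    (2 : ℝ≥0∞) ^ ((ν : ℝ) * σ) *
      (‖x ν k‖ₑ * (2 ^ (m * ν) * weightMass w (dyadicCube ν k)) ^ (p⁻¹).toReal) ≤
    besovSeqENorm w σ p q x := by
  refine le_trans ?_ (level_le_besovSeqENorm hq x ν)
  gcongr
  exact mul_rpow_le_weightedLpNorm hp (fun k => 2 ^ (m * ν) * weightMass w (dyadicCube ν k))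
    (fun k => ‖x ν k‖ₑ) k

theorem besovSeqENorm_eq_of_level (hp : p ≠ 0) (hq : q ≠ 0) (x : ℕ → (Fin m → ℤ) → ℂ) (ν : ℕ)
    (hx : ∀ ν', ν' ≠ ν → x ν' = 0) :
    besovSeqENorm w σ p q x = (2 : ℝ≥0∞) ^ ((ν : ℝ) * σ) *
      weightedLpNorm p (fun k => 2 ^ (m * ν) * weightMass w (dyadicCube ν k))
        (fun k => ‖x ν k‖ₑ) := by
  unfold besovSeqENorm
  rw [weightedLpNorm_eq_of_support hq _ _ ν]
  · simp
  · intro ν' hν'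
    simp [hx ν' hν', weightedLpNorm_zero hp]

theorem besovSeqENorm_single (hp : p ≠ 0) (hq : q ≠ 0) (ν : ℕ) (k : Fin m → ℤ) (c : ℂ) :
    besovSeqENorm w σ p q (Pi.single ν (Pi.single k c)) = (2 : ℝ≥0∞) ^ ((ν : ℝ) * σ) *
      (‖c‖ₑ * (2 ^ (m * ν) * weightMass w (dyadicCube ν k)) ^ (p⁻¹).toReal) := by
  rw [besovSeqENorm_eq_of_level hp hq _ ν fun ν' h => Pi.single_eq_of_ne h _,
    weightedLpNorm_eq_of_support hp _ _ k]
  · simp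
  · intro j hj
    simp [hj]

variable {hp : 0 < p} {hq : 0 < q}

theorem BesovSeq.norm_def (x : BesovSeq w σ p q hp hq) :
    ‖x‖ = (besovSeqENorm w σ p q (x : ℕ → (Fin m → ℤ) → ℂ)).toReal := rfl

theorem BesovSeq.ofReal_norm_eq (x : BesovSeq w σ p q hp hq) :
    ENNReal.ofReal ‖x‖ = besovSeqENorm w σ p q (x : ℕ → (Fin m → ℤ) → ℂ) :=
  ENNReal.ofReal_toReal x.2.ne

theorem BesovSeq.norm_nonneg' (x : BesovSeq w σ p q hp hq) : 0 ≤ ‖x‖ := ENNReal.toReal_nonneg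

theorem BesovSeq.norm_smul' (c : ℂ) (x : BesovSeq w σ p q hp hq) : ‖c • x‖ = ‖c‖ * ‖x‖ := by
  rw [BesovSeq.norm_def, BesovSeq.norm_def, Submodule.coe_smul,
    besovSeqENorm_smul hp.ne' hq.ne', ENNReal.toReal_mul, toReal_enorm]

/-- The coordinate functional `x ↦ x_{ν,k}`. -/
def BesovSeq.coord (ν : ℕ) (k : Fin m → ℤ) : BesovSeq w σ p q hp hq →ₗ[ℂ] ℂ :=
  ((LinearMap.proj k : ((Fin m → ℤ) → ℂ) →ₗ[ℂ] ℂ) ∘ₗ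
    (LinearMap.proj ν : (ℕ → (Fin m → ℤ) → ℂ) →ₗ[ℂ] ((Fin m → ℤ) → ℂ))) ∘ₗ
      (BesovSeq w σ p q hp hq).subtype

@[simp]
theorem BesovSeq.coord_apply (ν : ℕ) (k : Fin m → ℤ) (x : BesovSeq w σ p q hp hq) :
    BesovSeq.coord ν k x = (x : ℕ → (Fin m → ℤ) → ℂ) ν k := rfl

end Besov

section Estimates

variable {m : ℕ} {γ : Fin m → ℕ} {σ : ℝ} {p q : ℝ≥0∞}

theorem besovSeqENorm_single_le (hγ : ∀ i, 1 ≤ γ i) (hp : p ≠ 0) (hq : q ≠ 0) (ν : ℕ)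
    (k : Fin m → ℤ) (c : ℂ) :
    besovSeqENorm (blockWeight γ) σ p q (Pi.single ν (Pi.single k c)) ≤
      ‖c‖ₑ * 2 ^ (ν * σ + weightExponent γ ν k * (p⁻¹).toReal) := by
  rw [besovSeqENorm_single hp hq, mul_left_comm, ENNReal.rpow_add _ _ two_ne_zero (by simp),
    ENNReal.rpow_mul 2 (weightExponent γ ν k)]
  gcongr
  exact weightMass_dyadicCube_le γ hγ ν k

theorem enorm_coord_le (hγ : ∀ i, 1 ≤ γ i) (hp : p ≠ 0) (hq : q ≠ 0) (x : ℕ → (Fin m → ℤ) → ℂ)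
    (ν : ℕ) (k : Fin m → ℤ) :
    ‖x ν k‖ₑ * 2 ^ (ν * σ + (weightExponent γ ν k - 2 * ∑ i, (γ i : ℝ)) * (p⁻¹).toReal) ≤
      besovSeqENorm (blockWeight γ) σ p q x := by
  refine le_trans ?_ (coordinate_le_besovSeqENorm hp hq x ν k)
  rw [mul_left_comm, ENNReal.rpow_add _ _ two_ne_zero (by simp),
    ENNReal.rpow_mul 2 (weightExponent γ ν k - _)]
  gcongr
  exact le_weightMass_dyadicCube γ hγ ν k

variable {hp : 0 < p} {hq : 0 < q}

/-- The multiple `c e_{ν,k}` of a unit vector. -/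
def BesovSeq.single (hγ : ∀ i, 1 ≤ γ i) (ν : ℕ) (k : Fin m → ℤ) (c : ℂ) :
    BesovSeq (blockWeight γ) σ p q hp hq :=
  ⟨Pi.single ν (Pi.single k c), (besovSeqENorm_single_le hγ hp.ne' hq.ne' ν k c).trans_lt
    (ENNReal.mul_lt_top enorm_lt_top (by rw [← ofReal_two_rpow]; exact ENNReal.ofReal_lt_top))⟩

@[simp]
theorem BesovSeq.coe_single (hγ : ∀ i, 1 ≤ γ i) (ν : ℕ) (k : Fin m → ℤ) (c : ℂ) :
    ((BesovSeq.single hγ ν k c : BesovSeq (blockWeight γ) σ p q hp hq) :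
      ℕ → (Fin m → ℤ) → ℂ) = Pi.single ν (Pi.single k c) := rfl

theorem BesovSeq.norm_single_le (hγ : ∀ i, 1 ≤ γ i) (ν : ℕ) (k : Fin m → ℤ) (c : ℂ) :
    ‖(BesovSeq.single hγ ν k c : BesovSeq (blockWeight γ) σ p q hp hq)‖ ≤
      ‖c‖ * 2 ^ (ν * σ + weightExponent γ ν k * (p⁻¹).toReal) := by
  have := besovSeqENorm_single_le (σ := σ) hγ hp.ne' hq.ne' ν k c
  rw [← ofReal_norm, ← ofReal_two_rpow, ← ENNReal.ofReal_mul (norm_nonneg _)] at this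
  exact ENNReal.toReal_le_of_le_ofReal (by positivity) this

theorem BesovSeq.norm_coord_le (hγ : ∀ i, 1 ≤ γ i) (x : BesovSeq (blockWeight γ) σ p q hp hq)
    (ν : ℕ) (k : Fin m → ℤ) :
    ‖BesovSeq.coord ν k x‖ ≤
      2 ^ (-(ν * σ + (weightExponent γ ν k - 2 * ∑ i, (γ i : ℝ)) * (p⁻¹).toReal)) * ‖x‖ := by
  have := enorm_coord_le (σ := σ) hγ hp.ne' hq.ne' (x : ℕ → (Fin m → ℤ) → ℂ) ν k
  rw [← ofReal_norm, ← ofReal_two_rpow, ← ENNReal.ofReal_mul (norm_nonneg _),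
    ENNReal.ofReal_le_iff_le_toReal x.2.ne] at this
  rw [Real.rpow_neg two_pos.le, le_inv_mul_iff₀ (by positivity), mul_comm]
  exact this

end Estimates

/-! ### Necessity. -/

section Necessity

variable {m : ℕ} {γ : Fin m → ℕ} {p₁ p₂ q₁ q₂ : ℝ≥0∞} {hp₁ : 0 < p₁} {hp₂ : 0 < p₂}
  {hq₁ : 0 < q₁} {hq₂ : 0 < q₂} {σ₁ σ₂ : ℝ}

/-- Unit vectors normalised in the source, paired with inversely scaled coordinate functionals, are
biorthogonal. The exponent bounded by `C` is, up to a constant, the logarithm of the norm of these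
functionals on the target. -/
theorem not_idIsNuclear_of_bounded_exponent (hγ : ∀ i, 1 ≤ γ i)
    (h : IdIsNuclear (BesovSeq (blockWeight γ) σ₁ p₁ q₁ hp₁ hq₁)
      (BesovSeq (blockWeight γ) σ₂ p₂ q₂ hp₂ hq₂))
    (ν : ℕ → ℕ) (k : ℕ → Fin m → ℤ) (hinj : ∀ n n', n ≠ n' → ν n = ν n' → k n ≠ k n') {C : ℝ}
    (hC : ∀ n, ν n * (σ₁ - σ₂) +
      weightExponent γ (ν n) (k n) * ((p₁⁻¹).toReal - (p₂⁻¹).toReal) ≤ C) : False := by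
  obtain ⟨hle, hT⟩ := h
  set u : ℕ → ℝ := fun n => ν n * σ₁ + weightExponent γ (ν n) (k n) * (p₁⁻¹).toReal with hu
  have hpos : ∀ n, (0 : ℝ) < 2 ^ u n := fun n => by positivity
  refine hT.not_biorthogonal (K := 2 ^ (C + 2 * (∑ i, (γ i : ℝ)) * (p₂⁻¹).toReal))
    (x := fun n => BesovSeq.single hγ (ν n) (k n) (((2 ^ u n : ℝ)⁻¹ : ℝ) : ℂ))
    (f := fun n => (((2 : ℝ) ^ u n : ℝ) : ℂ) • BesovSeq.coord (ν n) (k n))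
    BesovSeq.norm_smul' BesovSeq.norm_nonneg' ?_ ?_ ?_ ?_
  · intro n
    refine (BesovSeq.norm_single_le hγ _ _ _).trans_eq ?_
    rw [Complex.norm_real, norm_inv, Real.norm_of_nonneg (hpos n).le]
    exact inv_mul_cancel₀ (hpos n).ne'
  · intro n z
    rw [LinearMap.smul_apply, norm_smul, Complex.norm_real, Real.norm_of_nonneg (hpos n).le]
    refine (mul_le_mul_of_nonneg_left (BesovSeq.norm_coord_le hγ z (ν n) (k n))
      (hpos n).le).trans ?_
    rw [← mul_assoc, ← Real.rpow_add two_pos]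
    refine mul_le_mul_of_nonneg_right ?_ (BesovSeq.norm_nonneg' z)
    refine Real.rpow_le_rpow_of_exponent_le one_le_two ?_
    have := hC n
    simp only [hu]
    linarith
  · intro n n' hn
    simp only [LinearMap.smul_apply, BesovSeq.coord_apply, Submodule.coe_inclusion,
      BesovSeq.coe_single, smul_eq_mul, mul_eq_zero]
    right
    by_cases hν : ν n = ν n'
    · rw [hν, Pi.single_eq_same, Pi.single_eq_of_ne (hinj n n' hn hν)]
    · rw [Pi.single_eq_of_ne hν, Pi.zero_apply]
  · intro n
    simp only [LinearMap.smul_apply, BesovSeq.coord_apply, Submodule.coe_inclusion,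
      BesovSeq.coe_single, smul_eq_mul, Pi.single_eq_same]
    rw [← Complex.ofReal_mul, mul_inv_cancel₀ (hpos n).ne', Complex.ofReal_one]

theorem lt_of_idIsNuclear_of_level (hγ : ∀ i, 1 ≤ γ i)
    (h : IdIsNuclear (BesovSeq (blockWeight γ) σ₁ p₁ q₁ hp₁ hq₁)
      (BesovSeq (blockWeight γ) σ₂ p₂ q₂ hp₂ hq₂)) :
    (∑ i, ((γ i : ℝ) - 1)) * ((p₁⁻¹).toReal - (p₂⁻¹).toReal) < σ₁ - σ₂ := by
  by_contra! hcon
  refine not_idIsNuclear_of_bounded_exponent hγ h id (fun _ => 0)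
    (fun n n' hn h' => absurd h' hn) (C := 0) fun n => ?_
  have : weightExponent γ n (0 : Fin m → ℤ) = - (n * ∑ i, ((γ i : ℝ) - 1)) := by
    rw [weightExponent, Finset.mul_sum, ← Finset.sum_neg_distrib]
    refine Finset.sum_congr rfl fun i _ => ?_
    simp [mul_comm]
  simp only [id_eq]
  rw [this]
  have hn : (0 : ℝ) ≤ n := n.cast_nonneg
  nlinarith

theorem weightExponent_zero_single (i : Fin m) (n : ℕ) :
    weightExponent γ 0 (Pi.single i (n : ℤ)) = ((γ i : ℝ) - 1) * Nat.size n := by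
  rw [weightExponent, Finset.sum_eq_single i]
  · simp
  · intro j _ hj
    simp [hj]
  · simp

theorem sub_pos_of_idIsNuclear (hγ : ∀ i, 1 ≤ γ i) (i : Fin m)
    (h : IdIsNuclear (BesovSeq (blockWeight γ) σ₁ p₁ q₁ hp₁ hq₁)
      (BesovSeq (blockWeight γ) σ₂ p₂ q₂ hp₂ hq₂)) :
    0 < (p₁⁻¹).toReal - (p₂⁻¹).toReal := by
  by_contra! hcon
  refine not_idIsNuclear_of_bounded_exponent hγ h (fun _ => 0) (fun n => Pi.single i (n : ℤ))
    (fun n n' hn _ h' => hn ?_) (C := 0) fun n => ?_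
  · exact_mod_cast Pi.single_injective i h'
  · rw [weightExponent_zero_single]
    have h1 : (1 : ℝ) ≤ γ i := by exact_mod_cast hγ i
    have h2 : 0 ≤ ((γ i : ℝ) - 1) * Nat.size n := mul_nonneg (by linarith) (by positivity)
    have := mul_nonpos_of_nonneg_of_nonpos h2 hcon
    simpa using this

/-- Trace duality with the diagonal operator on level `0` with entries `r_k`, taken from the target
back to the source: its trace is `∑ r_k` and Hölder bounds its norm. -/
theorem exists_sum_le_of_idIsNuclear (hγ : ∀ i, 1 ≤ γ i) {t : ℝ} (ht : 0 < t)
    (hpt : (p₁⁻¹).toReal = t + (p₂⁻¹).toReal)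
    (h : IdIsNuclear (BesovSeq (blockWeight γ) σ₁ p₁ q₁ hp₁ hq₁)
      (BesovSeq (blockWeight γ) σ₂ p₂ q₂ hp₂ hq₂)) :
    ∃ M : ℝ, ∀ (S : Finset (Fin m → ℤ)) (r : (Fin m → ℤ) → ℝ), (∀ k, 0 ≤ r k) →
      ∑ k ∈ S, r k ≤ M * (∑ k ∈ S, r k ^ (1 / t) * 2 ^ weightExponent γ 0 k) ^ t := by
  obtain ⟨hle, hT⟩ := h
  obtain ⟨M, hM⟩ := hT.exists_trace_le BesovSeq.norm_smul' BesovSeq.norm_nonneg'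
  refine ⟨M, fun S r hr => ?_⟩
  have key := hM (Fin m → ℤ) S (fun k => BesovSeq.single hγ 0 k (r k : ℂ))
    (fun k => BesovSeq.coord 0 k)
    ((∑ k ∈ S, r k ^ (1 / t) * 2 ^ weightExponent γ 0 k) ^ t)
    (fun k => ⟨_, fun z => BesovSeq.norm_coord_le hγ z 0 k⟩) ?_
  · simp only [BesovSeq.coord_apply, Submodule.coe_inclusion, BesovSeq.coe_single,
      Pi.single_eq_same] at key
    rw [← Complex.ofReal_sum, Complex.norm_real] at key
    exact (le_abs_self _).trans key
  · intro z
    have hnn : 0 ≤ ∑ k ∈ S, r k ^ (1 / t) * 2 ^ weightExponent γ 0 k :=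
      Finset.sum_nonneg fun k _ => mul_nonneg (Real.rpow_nonneg (hr k) _) (by positivity)
    rw [BesovSeq.norm_def]
    refine ENNReal.toReal_le_of_le_ofReal
      (mul_nonneg (Real.rpow_nonneg hnn _) (BesovSeq.norm_nonneg' z)) ?_
    rw [ENNReal.ofReal_mul (Real.rpow_nonneg hnn _), BesovSeq.ofReal_norm_eq,
      ← ENNReal.ofReal_rpow_of_nonneg hnn ht.le]
    set v : ℕ → (Fin m → ℤ) → ℂ := ((∑ k ∈ S, BesovSeq.coord 0 k z •
      (BesovSeq.single hγ 0 k (r k : ℂ) : BesovSeq (blockWeight γ) σ₁ p₁ q₁ hp₁ hq₁) :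
        BesovSeq (blockWeight γ) σ₁ p₁ q₁ hp₁ hq₁) : ℕ → (Fin m → ℤ) → ℂ) with hv
    have hv' : v = ∑ k ∈ S, (z : ℕ → (Fin m → ℤ) → ℂ) 0 k •
        (Pi.single 0 (Pi.single k (r k : ℂ)) : ℕ → (Fin m → ℤ) → ℂ) := by
      rw [hv]; push_cast; rfl
    have hv0 : ∀ ν, ν ≠ 0 → v ν = 0 := by
      intro ν hν
      rw [hv', Finset.sum_apply]
      exact Finset.sum_eq_zero fun k _ => by rw [Pi.smul_apply, Pi.single_eq_of_ne hν, smul_zero]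
    have hv1 : ∀ k, ‖v 0 k‖ₑ = (if k ∈ S then ENNReal.ofReal (r k) else 0) *
        ‖(z : ℕ → (Fin m → ℤ) → ℂ) 0 k‖ₑ := by
      intro k
      have : v 0 k = (if k ∈ S then (r k : ℂ) else 0) * (z : ℕ → (Fin m → ℤ) → ℂ) 0 k := by
        rw [hv', Finset.sum_apply, Finset.sum_apply]
        simp only [Pi.smul_apply, Pi.single_eq_same, smul_eq_mul, Pi.single_apply, mul_ite,
          Finset.sum_ite_eq, zero_mul, mul_comm]
      rw [this, enorm_mul]
      split_ifs
      · rw [← ofReal_norm, Complex.norm_real, Real.norm_of_nonneg (hr k)]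
      · simp
    rw [besovSeqENorm_eq_of_level hp₁.ne' hq₁.ne' v 0 hv0]
    simp_rw [hv1]
    refine le_trans ?_ (mul_le_mul' le_rfl
      (level_le_besovSeqENorm hq₂.ne' (z : ℕ → (Fin m → ℤ) → ℂ) 0))
    simp only [Nat.cast_zero, zero_mul, ENNReal.rpow_zero, one_mul]
    refine (weightedLpNorm_mul_le_mul hp₁.ne' hp₂.ne' ht hpt _ _ _).trans ?_
    gcongr
    rw [tsum_eq_sum (s := S), ENNReal.ofReal_sum_of_nonneg]
    · refine Finset.sum_le_sum fun k hk => ?_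
      rw [if_pos hk, ENNReal.ofReal_mul (Real.rpow_nonneg (hr k) _), ofReal_two_rpow,
        ENNReal.ofReal_rpow_of_nonneg (hr k) (by positivity)]
      gcongr
      exact weightMass_dyadicCube_le γ hγ 0 k
    · exact fun k _ => mul_nonneg (Real.rpow_nonneg (hr k) _) (by positivity)
    · intro k hk
      rw [if_neg hk, ENNReal.zero_rpow_of_pos (by positivity), zero_mul]

theorem one_div_lt_of_idIsNuclear (hγ : ∀ i, 1 ≤ γ i) (i : Fin m) (hi : 2 ≤ γ i)
    (h : IdIsNuclear (BesovSeq (blockWeight γ) σ₁ p₁ q₁ hp₁ hq₁)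
      (BesovSeq (blockWeight γ) σ₂ p₂ q₂ hp₂ hq₂)) :
    1 / (γ i : ℝ) < (p₁⁻¹).toReal - (p₂⁻¹).toReal := by
  have hpos := sub_pos_of_idIsNuclear hγ i h
  set t := (p₁⁻¹).toReal - (p₂⁻¹).toReal with ht
  by_contra! hcon
  have hg : (2 : ℝ) ≤ γ i := by exact_mod_cast hi
  have hgt : (γ i : ℝ) ≤ 1 / t := (le_one_div hpos (by linarith)).1 hcon
  have ht1 : t < 1 := by
    have : 1 / (γ i : ℝ) ≤ 1 / 2 := one_div_le_one_div_of_le two_pos hg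
    linarith
  obtain ⟨M, hM⟩ := exists_sum_le_of_idIsNuclear hγ hpos (by rw [ht]; ring) h
  set H : ℕ → ℝ := fun N => ∑ n ∈ Finset.range N, 1 / ((n : ℝ) + 1) with hH
  have hle : ∀ N, H N ≤ M * ((4 : ℝ) ^ ((γ i : ℝ) - 1) * H N) ^ t := by
    intro N
    have hinj : Function.Injective fun n : ℕ => (Pi.single i ((n + 1 : ℕ) : ℤ) : Fin m → ℤ) := by
      intro n n' hn
      have := Pi.single_injective i hn
      simpa using this
    -- The test entries are `r = 1/(n + 1)` on the `i`-th axis; as `1/t ≥ γ i`, the terms `r^{1/t}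
    -- 2^e` are again at most a constant times `1/(n + 1)`.
    have key := hM ((Finset.range N).image fun n : ℕ => (Pi.single i ((n + 1 : ℕ) : ℤ)))
      (fun k => |(k i : ℝ)|⁻¹) (fun k => by positivity)
    rw [Finset.sum_image hinj.injOn, Finset.sum_image hinj.injOn] at key
    have hM0 : 0 ≤ M := by
      have := hM {Pi.single i 0} (fun _ => 1) (fun _ => zero_le_one)
      simp only [Finset.sum_singleton] at this
      by_contra! hneg
      have h2 : 0 ≤ ((1 : ℝ) ^ (1 / t) * 2 ^ weightExponent γ 0 (Pi.single i 0)) ^ t := by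
        positivity
      nlinarith
    have e1 : ∀ n : ℕ, |(((Pi.single i ((n + 1 : ℕ) : ℤ) : Fin m → ℤ) i : ℤ) : ℝ)|⁻¹ =
        1 / ((n : ℝ) + 1) := by
      intro n
      rw [Pi.single_eq_same, one_div, abs_of_nonneg (by positivity)]
      push_cast; rfl
    simp_rw [e1] at key
    refine key.trans (mul_le_mul_of_nonneg_left ?_ hM0)
    refine Real.rpow_le_rpow (Finset.sum_nonneg fun n _ => by positivity) ?_ hpos.le
    rw [hH, Finset.mul_sum]
    refine Finset.sum_le_sum fun n _ => ?_
    have hn1 : (1 : ℝ) ≤ (n : ℝ) + 1 := by linarith [n.cast_nonneg (α := ℝ)]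
    have hn0 : (0 : ℝ) < (n : ℝ) + 1 := by linarith
    have e2 : (2 : ℝ) ^ weightExponent γ 0 (Pi.single i ((n + 1 : ℕ) : ℤ)) ≤
        (4 * ((n : ℝ) + 1)) ^ ((γ i : ℝ) - 1) := by
      rw [weightExponent_zero_single, mul_comm, Real.rpow_mul two_pos.le, Real.rpow_natCast]
      refine Real.rpow_le_rpow (by positivity) ?_ (by linarith)
      have := two_pow_size_le ((n + 1 : ℕ) : ℤ)
      rw [Int.natAbs_natCast, abs_of_nonneg (by positivity)] at this
      push_cast at this
      linarith
    calc (1 / ((n : ℝ) + 1)) ^ (1 / t) * 2 ^ weightExponent γ 0 (Pi.single i ((n + 1 : ℕ) : ℤ))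
        ≤ (1 / ((n : ℝ) + 1)) ^ (γ i : ℝ) * (4 * ((n : ℝ) + 1)) ^ ((γ i : ℝ) - 1) := by
          refine mul_le_mul (Real.rpow_le_rpow_of_exponent_ge (by positivity) ?_ hgt) e2
            (by positivity) (by positivity)
          exact (div_le_one hn0).2 hn1
      _ = 4 ^ ((γ i : ℝ) - 1) * (1 / ((n : ℝ) + 1)) := by
          rw [Real.mul_rpow (by norm_num) hn0.le, one_div, Real.inv_rpow hn0.le,
            Real.rpow_sub_one hn0.ne' (γ i : ℝ)]
          have : ((n : ℝ) + 1) ^ (γ i : ℝ) ≠ 0 := by positivity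
          field_simp
  have hlim : Tendsto H atTop atTop := Real.tendsto_sum_range_one_div_nat_succ_atTop
  have hlim2 : Tendsto (fun N => H N ^ (1 - t)) atTop atTop :=
    (tendsto_rpow_atTop (by linarith)).comp hlim
  obtain ⟨N, hN, hN1⟩ := ((hlim2.eventually_gt_atTop (M * ((4 : ℝ) ^ ((γ i : ℝ) - 1)) ^ t)).and
    (hlim.eventually_gt_atTop 0)).exists
  have := hle N
  rw [Real.mul_rpow (by positivity) hN1.le, ← mul_assoc] at this
  have h3 : H N = H N ^ (1 - t) * H N ^ t := by
    rw [← Real.rpow_add hN1, sub_add_cancel, Real.rpow_one]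
  have h4 : 0 < H N ^ t := Real.rpow_pos_of_pos hN1 t
  nlinarith

end Necessity

/-! ### Blocks of equal size and their Fourier bases. -/

/-- Identify `S` with `ℤ/N` and take its characters: the kernel is the discrete Fourier matrix, and
the identity is orthogonality of its columns. -/
theorem exists_fourier_kernel {α : Type*} [DecidableEq α] (S : Finset α) (hS : S.Nonempty) :
    ∃ u : α → α → ℂ, (∀ k l, ‖u k l‖ ≤ 1) ∧
      ∀ l ∈ S, ∀ l' ∈ S, ∑ k ∈ S, star (u k l) * u k l' = if l = l' then (S.card : ℂ) else 0 := by
  have : NeZero S.card := ⟨hS.card_ne_zero⟩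
  obtain ⟨e⟩ : Nonempty (S ≃ ZMod S.card) := ⟨Fintype.equivOfCardEq (by simp [ZMod.card])⟩
  let g : α → ZMod S.card := fun k => if h : k ∈ S then e ⟨k, h⟩ else 0
  have hg : ∀ k : S, g k = e k := fun k => by simp [g]
  refine ⟨fun k l => ZMod.stdAddChar (g k * g l), fun k l => (AddChar.norm_apply _ _).le, ?_⟩
  intro l hl l' hl'
  have h1 : ∀ k : α, star (ZMod.stdAddChar (g k * g l)) * ZMod.stdAddChar (g k * g l') =
      (ZMod.stdAddChar (g k * (g l' - g l)) : ℂ) := by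
    intro k
    rw [mul_sub, sub_eq_neg_add, AddChar.map_add_eq_mul, AddChar.map_neg_eq_conj]
    rfl
  simp_rw [h1]
  rw [← Finset.sum_coe_sort S fun k => (ZMod.stdAddChar (g k * (g l' - g l)) : ℂ)]
  simp_rw [hg]
  rw [e.sum_comp fun x => (ZMod.stdAddChar (x * (g l' - g l)) : ℂ),
    AddChar.sum_mulShift _ (ZMod.isPrimitive_stdAddChar _), ZMod.card]
  have h2 : g l' - g l = 0 ↔ l = l' := by
    rw [sub_eq_zero, hg ⟨l', hl'⟩, hg ⟨l, hl⟩, e.injective.eq_iff, Subtype.mk.injEq, eq_comm]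
  simp only [h2]
  split_ifs <;> simp

/-- The integers with `size |k| = j`. -/
noncomputable def sizeBlock (j : ℕ) : Finset ℤ :=
  (Finset.Ioo (-2 ^ j : ℤ) (2 ^ j)).filter fun k => Nat.size k.natAbs = j

theorem mem_sizeBlock {j : ℕ} {k : ℤ} : k ∈ sizeBlock j ↔ Nat.size k.natAbs = j := by
  rw [sizeBlock, Finset.mem_filter, and_iff_right_iff_imp]
  rintro rfl
  have h := Nat.lt_size_self k.natAbs
  rw [Finset.mem_Ioo, ← abs_lt, ← Int.natCast_natAbs]
  exact_mod_cast h

/-- Two signs times `2^{j-1}` absolute values for `j ≥ 1`; the block `{0}` for `j = 0` fits the same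
formula. -/
theorem card_sizeBlock (j : ℕ) : (sizeBlock j).card = 2 ^ j := by
  have hsize : ∀ (j : ℕ) (k : ℤ), Nat.size k.natAbs ≤ j ↔ k ∈ Finset.Ioo (-2 ^ j : ℤ) (2 ^ j) := by
    intro j k
    rw [Nat.size_le, Finset.mem_Ioo, ← abs_lt, ← Int.natCast_natAbs]
    norm_cast
  rcases j with _ | j
  · have : sizeBlock 0 = {0} := by
      ext k
      rw [mem_sizeBlock, Nat.size_eq_zero, Int.natAbs_eq_zero, Finset.mem_singleton]
    simp [this]
  · have : sizeBlock (j + 1) =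
        Finset.Ioo (-2 ^ (j + 1) : ℤ) (2 ^ (j + 1)) \ Finset.Ioo (-2 ^ j : ℤ) (2 ^ j) := by
      ext k
      rw [mem_sizeBlock, Finset.mem_sdiff, ← hsize, ← hsize]
      omega
    rw [this, Finset.card_sdiff_of_subset, Int.card_Ioo, Int.card_Ioo]
    · have : (1 : ℤ) ≤ 2 ^ j := one_le_pow₀ (by norm_num)
      zify
      rw [pow_succ]
      omega
    · intro k
      rw [← hsize, ← hsize]
      omega

/-- The multiindices `l` with `size |l_i| = size |k_i|` for all `i`. -/
noncomputable def indexBlock {m : ℕ} (k : Fin m → ℤ) : Finset (Fin m → ℤ) :=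
  Fintype.piFinset fun i => sizeBlock (Nat.size (k i).natAbs)

theorem mem_indexBlock {m : ℕ} {k l : Fin m → ℤ} :
    l ∈ indexBlock k ↔ ∀ i, Nat.size (l i).natAbs = Nat.size (k i).natAbs := by
  simp [indexBlock, Fintype.mem_piFinset, mem_sizeBlock]

theorem self_mem_indexBlock {m : ℕ} (k : Fin m → ℤ) : k ∈ indexBlock k :=
  mem_indexBlock.2 fun _ => rfl

theorem mem_indexBlock_comm {m : ℕ} {k l : Fin m → ℤ} : l ∈ indexBlock k ↔ k ∈ indexBlock l := by
  simp only [mem_indexBlock, eq_comm]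

theorem indexBlock_eq_of_mem {m : ℕ} {k l : Fin m → ℤ} (h : l ∈ indexBlock k) :
    indexBlock l = indexBlock k := by
  rw [mem_indexBlock] at h
  simp only [indexBlock, h]

theorem card_indexBlock {m : ℕ} (k : Fin m → ℤ) :
    (indexBlock k).card = 2 ^ ∑ i, Nat.size (k i).natAbs := by
  simp [indexBlock, card_sizeBlock, Finset.prod_pow_eq_pow_sum]

theorem exists_block_kernel (m : ℕ) :
    ∃ U : (Fin m → ℤ) → (Fin m → ℤ) → ℂ, (∀ k l, ‖U k l‖ ≤ 1) ∧
      ∀ l, ∀ l' ∈ indexBlock l, ∑ k ∈ indexBlock l, star (U k l) * U k l' =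
        if l = l' then ((indexBlock l).card : ℂ) else 0 := by
  have h : ∀ S : Finset (Fin m → ℤ), ∃ u : (Fin m → ℤ) → (Fin m → ℤ) → ℂ, S.Nonempty →
      (∀ k l, ‖u k l‖ ≤ 1) ∧ ∀ l ∈ S, ∀ l' ∈ S, ∑ k ∈ S, star (u k l) * u k l' =
        if l = l' then (S.card : ℂ) else 0 := by
    intro S
    by_cases hS : S.Nonempty
    · obtain ⟨u, hu⟩ := exists_fourier_kernel S hS
      exact ⟨u, fun _ => hu⟩
    · exact ⟨0, fun h => absurd h hS⟩
  choose u hu using h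
  have hne : ∀ l : Fin m → ℤ, (indexBlock l).Nonempty := fun l => ⟨l, self_mem_indexBlock l⟩
  refine ⟨fun k l => u (indexBlock l) k l, fun k l => (hu _ (hne l)).1 k l, fun l l' hl' => ?_⟩
  simp only [indexBlock_eq_of_mem hl']
  exact (hu _ (hne l)).2 l (self_mem_indexBlock l) l' hl'

/-! ### Convergence of the model series. -/

theorem ennreal_tsum_pi_prod {ι : Type*} : ∀ {m : ℕ} (f : Fin m → ι → ℝ≥0∞),
    ∑' k : Fin m → ι, ∏ i, f i (k i) = ∏ i, ∑' j, f i j := by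
  intro m
  induction m with
  | zero =>
    intro f
    rw [tsum_eq_single default fun k hk => absurd (Subsingleton.elim k _) hk]
    simp
  | succ m ih =>
    intro f
    rw [← (Fin.consEquiv fun _ : Fin (m + 1) => ι).tsum_eq, ENNReal.tsum_prod', Fin.prod_univ_succ,
      ← ih, ← ENNReal.tsum_mul_right]
    refine tsum_congr fun a => ?_
    rw [← ENNReal.tsum_mul_left]
    refine tsum_congr fun b => ?_
    simp [Fin.consEquiv, Fin.prod_univ_succ]

theorem tsum_two_rpow_nat_ne_top {θ : ℝ} (hθ : 0 < θ) :
    ∑' ν : ℕ, (2 : ℝ≥0∞) ^ (-(ν * θ)) ≠ ∞ := by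
  have h : ∀ ν : ℕ, (2 : ℝ≥0∞) ^ (-(ν * θ)) = (2 ^ (-θ)) ^ ν := fun ν => by
    rw [← ENNReal.rpow_natCast, ← ENNReal.rpow_mul]
    ring_nf
  simp_rw [h]
  rw [ENNReal.tsum_geometric]
  simp only [ne_eq, ENNReal.inv_eq_top, tsub_eq_zero_iff_le, not_le]
  exact ENNReal.rpow_lt_one_of_one_lt_of_neg ENNReal.one_lt_two (by linarith)

theorem tsum_two_rpow_size_ne_top {a : ℝ} (ha : 1 < a) :
    ∑' k : ℤ, (2 : ℝ≥0∞) ^ (-(a * Nat.size k.natAbs)) ≠ ∞ := by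
  -- The shift by `1/2` avoids the singular term at `k = 0`.
  have hs := (Real.summable_one_div_int_add_rpow (1 / 2) a).2 ha
  refine ne_top_of_le_ne_top hs.tsum_ofReal_ne_top (ENNReal.tsum_le_tsum fun k => ?_)
  rw [← ofReal_two_rpow]
  refine ENNReal.ofReal_le_ofReal ?_
  have h0 : 0 < |(k : ℝ) + 1 / 2| := by
    rw [abs_pos]
    intro h
    have h2 : (2 * k + 1 : ℝ) = 0 := by linarith
    have h3 : 2 * k + 1 = 0 := by exact_mod_cast h2
    omega
  have h1 : |(k : ℝ) + 1 / 2| ≤ 2 ^ Nat.size k.natAbs := by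
    refine le_trans ?_ (abs_add_one_le_two_pow_size k)
    refine (abs_add_le _ _).trans ?_
    rw [abs_of_pos (by norm_num : (0 : ℝ) < 1 / 2)]
    linarith
  rw [Real.rpow_neg two_pos.le, mul_comm, Real.rpow_mul two_pos.le, Real.rpow_natCast, one_div]
  gcongr

/-! ### Sufficiency: the block Fourier expansion. -/

section Sufficiency

variable {m : ℕ} {γ : Fin m → ℕ} {p p₁ p₂ q q₁ q₂ : ℝ≥0∞} {hp : 0 < p} {hq : 0 < q}
  {hp₁ : 0 < p₁} {hp₂ : 0 < p₂} {hq₁ : 0 < q₁} {hq₂ : 0 < q₂} {σ σ₁ σ₂ : ℝ}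

theorem weightExponent_eq_of_mem {ν : ℕ} {k l : Fin m → ℤ} (h : l ∈ indexBlock k) :
    weightExponent γ ν l = weightExponent γ ν k := by
  rw [mem_indexBlock] at h
  simp only [weightExponent, h]

/-- The functional `x ↦ (#B)⁻¹ ∑_{l ∈ B} conj (U_{k,l}) x_{ν,l}`, where `B` is the block of `k`. -/
noncomputable def BesovSeq.blockCoeff {w : (Fin m → ℝ) → ℝ} (U : (Fin m → ℤ) → (Fin m → ℤ) → ℂ) (ν : ℕ)
    (k : Fin m → ℤ) : BesovSeq w σ p q hp hq →ₗ[ℂ] ℂ :=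
  ((indexBlock k).card : ℂ)⁻¹ • ∑ l ∈ indexBlock k, star (U k l) • BesovSeq.coord ν l

/-- The sequence with entries `U_{k,l}` at `(ν,l)`, `l` in the block of `k`, and zero elsewhere. -/
noncomputable def blockWave (U : (Fin m → ℤ) → (Fin m → ℤ) → ℂ) (ν : ℕ) (k : Fin m → ℤ) :
    ℕ → (Fin m → ℤ) → ℂ :=
  Pi.single ν fun l => if l ∈ indexBlock k then U k l else 0

theorem card_indexBlock_ennreal (k : Fin m → ℤ) :
    ((indexBlock k).card : ℝ≥0∞) = 2 ^ (∑ i, (Nat.size (k i).natAbs : ℝ)) := by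
  rw [card_indexBlock]
  push_cast
  rw [← ENNReal.rpow_natCast]
  push_cast
  rfl

theorem two_rpow_ne_top (x : ℝ) : (2 : ℝ≥0∞) ^ x ≠ ∞ := by
  rw [← ofReal_two_rpow]; exact ENNReal.ofReal_ne_top

theorem two_rpow_ne_zero (x : ℝ) : (2 : ℝ≥0∞) ^ x ≠ 0 := by
  rw [← ofReal_two_rpow]; simp; positivity

theorem two_rpow_add (x y : ℝ) : (2 : ℝ≥0∞) ^ (x + y) = 2 ^ x * 2 ^ y :=
  ENNReal.rpow_add _ _ two_ne_zero (by simp)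

theorem BesovSeq.enorm_blockCoeff_le (hγ : ∀ i, 1 ≤ γ i) (hp1 : 1 ≤ p)
    {U : (Fin m → ℤ) → (Fin m → ℤ) → ℂ} (hU : ∀ k l, ‖U k l‖ ≤ 1) (ν : ℕ) (k : Fin m → ℤ)
    (x : BesovSeq (blockWeight γ) σ p q hp hq) :
    ‖BesovSeq.blockCoeff U ν k x‖ₑ ≤
      2 ^ (-((∑ i, (Nat.size (k i).natAbs : ℝ) + weightExponent γ ν k - 2 * ∑ i, (γ i : ℝ)) *
        (p⁻¹).toReal) - ν * σ) *
      besovSeqENorm (blockWeight γ) σ p q (x : ℕ → (Fin m → ℤ) → ℂ) := by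
  have hU' : ∀ k l, ‖star (U k l)‖ₑ ≤ 1 := fun k l => by
    rw [← ofReal_norm, norm_star]
    exact ENNReal.ofReal_le_one.2 (hU k l)
  have hne : (indexBlock k).Nonempty := ⟨k, self_mem_indexBlock k⟩
  set v : (Fin m → ℤ) → ℂ := (x : ℕ → (Fin m → ℤ) → ℂ) ν with hv
  have h1 : ‖BesovSeq.blockCoeff U ν k x‖ₑ ≤
      ((indexBlock k).card : ℝ≥0∞)⁻¹ * ∑ l ∈ indexBlock k, ‖v l‖ₑ := by
    simp only [BesovSeq.blockCoeff, LinearMap.smul_apply, LinearMap.sum_apply, smul_eq_mul,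
      enorm_mul, BesovSeq.coord_apply]
    gcongr
    · rw [enorm_inv (by simpa using hne.ne_empty), ← ofReal_norm, Complex.norm_natCast,
        ENNReal.ofReal_natCast]
    · refine (enorm_sum_le _ _).trans (Finset.sum_le_sum fun l _ => ?_)
      rw [enorm_mul]
      exact mul_le_of_le_one_left' (hU' k l)
  refine h1.trans ((sum_le_weightedLpNorm hp1 (fun l => ‖v l‖ₑ) (indexBlock k) hne
    (W := fun k => 2 ^ (m * ν) * weightMass (blockWeight γ) (dyadicCube ν k))
    (c := 2 ^ (weightExponent γ ν k - 2 * ∑ i, (γ i : ℝ)))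
    (two_rpow_ne_zero _) (two_rpow_ne_top _) fun l hl => ?_).trans ?_)
  · rw [← weightExponent_eq_of_mem hl]
    exact le_weightMass_dyadicCube γ hγ ν l
  · rw [card_indexBlock_ennreal, ← two_rpow_add, ← ENNReal.rpow_mul]
    refine le_trans (le_of_eq ?_) (mul_le_mul' le_rfl
      (level_le_besovSeqENorm hq.ne' (x : ℕ → (Fin m → ℤ) → ℂ) ν))
    rw [← mul_assoc, ← two_rpow_add]
    congr 2
    ring

theorem besovSeqENorm_blockWave_le (hγ : ∀ i, 1 ≤ γ i) (hp : p ≠ 0) (hq : q ≠ 0)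
    {U : (Fin m → ℤ) → (Fin m → ℤ) → ℂ} (hU : ∀ k l, ‖U k l‖ ≤ 1) (ν : ℕ) (k : Fin m → ℤ) :
    besovSeqENorm (blockWeight γ) σ p q (blockWave U ν k) ≤
      2 ^ ((∑ i, (Nat.size (k i).natAbs : ℝ) + weightExponent γ ν k) * (p⁻¹).toReal + ν * σ) := by
  rw [besovSeqENorm_eq_of_level hp hq _ ν fun ν' h => Pi.single_eq_of_ne h _, add_comm _ (ν * σ),
    two_rpow_add, ENNReal.rpow_mul 2 (_ + _), two_rpow_add, ← card_indexBlock_ennreal]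
  gcongr
  refine weightedLpNorm_le_of_subset hp (indexBlock k) (fun l => ?_) (fun l hl => ?_)
    fun l hl => ?_
  · rw [blockWave, Pi.single_eq_same]
    split_ifs
    · rw [← ofReal_norm]
      exact ENNReal.ofReal_le_one.2 (hU k l)
    · simp
  · rw [blockWave, Pi.single_eq_same, if_neg hl, enorm_zero]
  · rw [← weightExponent_eq_of_mem hl]
    exact weightMass_dyadicCube_le γ hγ ν l

/-- Fourier inversion on the block of `k`. Only the finitely many indices of that block on level `ν`
contribute to the coordinate `(ν, k)`. -/
theorem BesovSeq.hasSum_blockCoeff {w : (Fin m → ℝ) → ℝ} {U : (Fin m → ℤ) → (Fin m → ℤ) → ℂ}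
    (hU : ∀ l, ∀ l' ∈ indexBlock l, ∑ k ∈ indexBlock l, star (U k l) * U k l' =
        if l = l' then ((indexBlock l).card : ℂ) else 0)
    (x : BesovSeq w σ p q hp hq) (ν : ℕ) (k : Fin m → ℤ) :
    HasSum (fun α : ℕ × (Fin m → ℤ) => BesovSeq.blockCoeff U α.1 α.2 x * blockWave U α.1 α.2 ν k)
      ((x : ℕ → (Fin m → ℤ) → ℂ) ν k) := by
  classical
  have hne : ((indexBlock k).card : ℂ) ≠ 0 := by
    simpa using Finset.ne_empty_of_mem (self_mem_indexBlock k)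
  have hsum : ∑ α ∈ (indexBlock k).map ⟨fun l => (ν, l), Prod.mk_right_injective ν⟩,
      BesovSeq.blockCoeff U α.1 α.2 x * blockWave U α.1 α.2 ν k =
      (x : ℕ → (Fin m → ℤ) → ℂ) ν k := by
    rw [Finset.sum_map]
    simp only [Function.Embedding.coeFn_mk]
    have h1 : ∀ k' ∈ indexBlock k, BesovSeq.blockCoeff U ν k' x * blockWave U ν k' ν k =
        ((indexBlock k).card : ℂ)⁻¹ * ∑ l ∈ indexBlock k,
          (star (U k' l) * U k' k) * (x : ℕ → (Fin m → ℤ) → ℂ) ν l := by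
      intro k' hk'
      rw [blockWave, Pi.single_eq_same, if_pos (mem_indexBlock_comm.1 hk')]
      simp only [BesovSeq.blockCoeff, LinearMap.smul_apply, LinearMap.sum_apply, smul_eq_mul,
        BesovSeq.coord_apply, indexBlock_eq_of_mem hk', mul_assoc, Finset.sum_mul]
      congr 1
      exact Finset.sum_congr rfl fun l _ => by ring
    rw [Finset.sum_congr rfl h1, ← Finset.mul_sum, Finset.sum_comm]
    simp_rw [← Finset.sum_mul]
    have h2 : ∀ l ∈ indexBlock k, (∑ k' ∈ indexBlock k, star (U k' l) * U k' k) *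
        (x : ℕ → (Fin m → ℤ) → ℂ) ν l =
        if k = l then ((indexBlock k).card : ℂ) * (x : ℕ → (Fin m → ℤ) → ℂ) ν k else 0 := by
      intro l hl
      have := hU l k (mem_indexBlock_comm.1 hl)
      rw [indexBlock_eq_of_mem hl] at this
      rw [this]
      by_cases h : k = l
      · simp [h]
      · simp [h, Ne.symm h]
    rw [Finset.sum_congr rfl h2, Finset.sum_ite_eq, if_pos (self_mem_indexBlock k), ← mul_assoc,
      inv_mul_cancel₀ hne, one_mul]
  rw [← hsum]
  refine hasSum_sum_of_ne_finset_zero fun α hα => ?_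
  obtain ⟨ν', k'⟩ := α
  have h0 : blockWave U ν' k' ν k = 0 := by
    unfold blockWave
    by_cases hν : ν = ν'
    · subst hν
      rw [Pi.single_eq_same, if_neg]
      intro hk
      exact hα (Finset.mem_map.2 ⟨k', mem_indexBlock_comm.1 hk, rfl⟩)
    · rw [Pi.single_eq_of_ne hν, Pi.zero_apply]
  rw [h0, mul_zero]

end Sufficiency

/-! ### Sufficiency: summing the expansion. -/

section Sufficiency

variable {m : ℕ} {γ : Fin m → ℕ} {p₁ p₂ q₁ q₂ : ℝ≥0∞}
  {hp₁ : 0 < p₁} {hp₂ : 0 < p₂} {hq₁ : 0 < q₁} {hq₂ : 0 < q₂} {σ₁ σ₂ : ℝ}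

/-- A bound for `‖a‖ ‖y‖`, where `a` and `y` are the block functional and the block sequence of
index `(ν, k)`. -/
noncomputable def blockBound (γ : Fin m → ℕ) (c δ ε : ℝ) (α : ℕ × (Fin m → ℤ)) : ℝ≥0∞ :=
  2 ^ c * (2 ^ (-(α.1 * ε)) * ∏ i, 2 ^ (-(δ * γ i * Nat.size (α.2 i).natAbs)))

theorem tsum_blockBound_ne_top {c δ ε : ℝ} (hε : 0 < ε) (hδ : ∀ i, 1 < δ * γ i) :
    ∑' α, blockBound γ c δ ε α ≠ ∞ := by
  unfold blockBound
  rw [ENNReal.tsum_mul_left, ENNReal.tsum_prod']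
  simp_rw [ENNReal.tsum_mul_left]
  rw [ENNReal.tsum_mul_right,
    ennreal_tsum_pi_prod fun i (j : ℤ) => (2 : ℝ≥0∞) ^ (-(δ * γ i * Nat.size j.natAbs))]
  exact ENNReal.mul_ne_top (two_rpow_ne_top _) (ENNReal.mul_ne_top (tsum_two_rpow_nat_ne_top hε)
    (ENNReal.prod_ne_top fun i _ => tsum_two_rpow_size_ne_top (hδ i)))

theorem weightedLpNorm_two_rpow_ne_top {q : ℝ≥0∞} (hq : q ≠ 0) {θ : ℝ} (hθ : 0 < θ) :
    weightedLpNorm q (fun _ : ℕ => 1) (fun ν => 2 ^ (-(ν * θ))) ≠ ∞ := by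
  unfold weightedLpNorm
  split_ifs with h
  · refine ne_top_of_le_ne_top ENNReal.one_ne_top (iSup_le fun ν => ?_)
    rw [← ENNReal.rpow_zero (x := 2)]
    refine ENNReal.rpow_le_rpow_of_exponent_le one_le_two ?_
    have : 0 ≤ (ν : ℝ) * θ := by positivity
    linarith
  · have ht : 0 < q.toReal := ENNReal.toReal_pos hq h
    refine ENNReal.rpow_ne_top_of_nonneg (by positivity) ?_
    simp_rw [mul_one, ← ENNReal.rpow_mul, neg_mul, mul_assoc]
    exact tsum_two_rpow_nat_ne_top (by positivity)

/-- The sum of the exponents in the bounds for a block functional and a block sequence. -/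
theorem block_exponent_eq {i₁ i₂ ε : ℝ} (hε : 2 * ε = σ₁ - σ₂ - (∑ i, ((γ i : ℝ) - 1)) * (i₁ - i₂))
    (ν : ℕ) (k : Fin m → ℤ) :
    (2 : ℝ≥0∞) ^ (-((∑ i, (Nat.size (k i).natAbs : ℝ) + weightExponent γ ν k -
        2 * ∑ i, (γ i : ℝ)) * i₁) - ν * σ₁) *
      2 ^ ((∑ i, (Nat.size (k i).natAbs : ℝ) + weightExponent γ ν k) * i₂ + ν * σ₂) =
    2 ^ (-(ν * ε)) * blockBound γ (2 * (∑ i, (γ i : ℝ)) * i₁) (i₁ - i₂) ε (ν, k) := by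
  have h1 : ∑ i, (Nat.size (k i).natAbs : ℝ) + weightExponent γ ν k =
      ∑ i, (γ i : ℝ) * Nat.size (k i).natAbs - ν * ∑ i, ((γ i : ℝ) - 1) := by
    rw [weightExponent, ← Finset.sum_add_distrib, Finset.mul_sum, ← Finset.sum_sub_distrib]
    exact Finset.sum_congr rfl fun i _ => by ring
  have h2 : ∏ i, (2 : ℝ≥0∞) ^ (-((i₁ - i₂) * γ i * Nat.size (k i).natAbs)) =
      2 ^ (-((i₁ - i₂) * ∑ i, (γ i : ℝ) * Nat.size (k i).natAbs)) := by
    rw [Finset.mul_sum, ← Finset.sum_neg_distrib]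
    simp_rw [mul_assoc]
    induction (Finset.univ : Finset (Fin m)) using Finset.induction_on with
    | empty => simp
    | insert a s ha ih => rw [Finset.prod_insert ha, Finset.sum_insert ha, ih, two_rpow_add]
  unfold blockBound
  simp only [h2]
  rw [← two_rpow_add, ← two_rpow_add, ← two_rpow_add, ← two_rpow_add, h1]
  congr 1
  linear_combination (ν : ℝ) * hε

/-- Minkowski is applied only inside each level, where `p₂ ≥ 1`. A spare factor `2^{-νε}` then makes
the outer `ℓ_{q₂}` quasi-norm finite even for `q₂ < 1`, uniformly in `A`. -/
theorem BesovSeq.besovSeqENorm_sub_sum_le (hγ : ∀ i, 1 ≤ γ i) (hp₁' : 1 ≤ p₁) (hp₂' : 1 ≤ p₂)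
    (hq₂ : q₂ ≠ 0)
    {U : (Fin m → ℤ) → (Fin m → ℤ) → ℂ} (hU : ∀ k l, ‖U k l‖ ≤ 1)
    (hU' : ∀ l, ∀ l' ∈ indexBlock l, ∑ k ∈ indexBlock l, star (U k l) * U k l' =
        if l = l' then ((indexBlock l).card : ℂ) else 0) {ε : ℝ}
    (hε : 2 * ε = σ₁ - σ₂ - (∑ i, ((γ i : ℝ) - 1)) * ((p₁⁻¹).toReal - (p₂⁻¹).toReal))
    (x : BesovSeq (blockWeight γ) σ₁ p₁ q₁ hp₁ hq₁) (A : Finset (ℕ × (Fin m → ℤ))) :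
    besovSeqENorm (blockWeight γ) σ₂ p₂ q₂ ((x : ℕ → (Fin m → ℤ) → ℂ) -
      ∑ α ∈ A, BesovSeq.blockCoeff U α.1 α.2 x • blockWave U α.1 α.2) ≤
    ((∑' α : {α // α ∉ A}, blockBound γ (2 * (∑ i, (γ i : ℝ)) * (p₁⁻¹).toReal)
      ((p₁⁻¹).toReal - (p₂⁻¹).toReal) ε α) *
      besovSeqENorm (blockWeight γ) σ₁ p₁ q₁ (x : ℕ → (Fin m → ℤ) → ℂ)) *
      weightedLpNorm q₂ (fun _ : ℕ => 1) (fun ν => 2 ^ (-(ν * ε))) := by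
  have hp₂ : p₂ ≠ 0 := (zero_lt_one.trans_le hp₂').ne'
  set v := (x : ℕ → (Fin m → ℤ) → ℂ) - ∑ α ∈ A,
    BesovSeq.blockCoeff U α.1 α.2 x • blockWave U α.1 α.2 with hv
  have hcoord : ∀ ν k, ‖v ν k‖ₑ ≤ ∑' α : {α // α ∉ A},
      ‖BesovSeq.blockCoeff U α.1.1 α.1.2 x‖ₑ * ‖blockWave U α.1.1 α.1.2 ν k‖ₑ := by
    intro ν k
    have hs := BesovSeq.hasSum_blockCoeff hU' x ν k
    have h1 : v ν k = ∑' α : {α // α ∉ A},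
        BesovSeq.blockCoeff U α.1.1 α.1.2 x * blockWave U α.1.1 α.1.2 ν k := by
      rw [hv, Pi.sub_apply, Pi.sub_apply, ← hs.tsum_eq, ← hs.summable.sum_add_tsum_subtype_compl A,
        Finset.sum_apply, Finset.sum_apply]
      simp
    rw [h1]
    simp_rw [← enorm_mul]
    exact enorm_tsum_le_tsum_enorm
  rw [← weightedLpNorm_const_mul hq₂]
  refine weightedLpNorm_mono _ _ fun ν => ?_
  calc _ ≤ (2 : ℝ≥0∞) ^ (ν * σ₂) * weightedLpNorm p₂
          (fun k => 2 ^ (m * ν) * weightMass (blockWeight γ) (dyadicCube ν k))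
          (fun k => ∑' α : {α // α ∉ A}, ‖BesovSeq.blockCoeff U α.1.1 α.1.2 x‖ₑ *
            ‖blockWave U α.1.1 α.1.2 ν k‖ₑ) :=
        mul_le_mul' le_rfl (weightedLpNorm_mono _ _ fun k => hcoord ν k)
    _ ≤ (2 : ℝ≥0∞) ^ (ν * σ₂) * ∑' α : {α // α ∉ A}, weightedLpNorm p₂
          (fun k => 2 ^ (m * ν) * weightMass (blockWeight γ) (dyadicCube ν k))
          (fun k => ‖BesovSeq.blockCoeff U α.1.1 α.1.2 x‖ₑ *
            ‖blockWave U α.1.1 α.1.2 ν k‖ₑ) :=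
        mul_le_mul' le_rfl (weightedLpNorm_tsum_le hp₂' _ _)
    _ ≤ ∑' α : {α // α ∉ A}, (blockBound γ (2 * (∑ i, (γ i : ℝ)) * (p₁⁻¹).toReal)
      ((p₁⁻¹).toReal - (p₂⁻¹).toReal) ε α *
      besovSeqENorm (blockWeight γ) σ₁ p₁ q₁ (x : ℕ → (Fin m → ℤ) → ℂ)) * 2 ^ (-(ν * ε)) := by
        rw [← ENNReal.tsum_mul_left]
        refine ENNReal.tsum_le_tsum fun α => ?_
        obtain ⟨⟨ν', k⟩, -⟩ := α
        by_cases hν : ν = ν'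
        · subst hν
          rw [weightedLpNorm_const_mul hp₂, mul_left_comm]
          have h2 := (level_le_besovSeqENorm hq₂ (blockWave U ν k) ν).trans
            (besovSeqENorm_blockWave_le (σ := σ₂) hγ hp₂ hq₂ hU ν k)
          refine (mul_le_mul' (BesovSeq.enorm_blockCoeff_le hγ hp₁' hU ν k x) h2).trans_eq ?_
          rw [mul_right_comm, block_exponent_eq hε]
          ring
        · have : ∀ l, blockWave U ν' k ν l = 0 := fun l => by
            rw [blockWave, Pi.single_eq_of_ne hν, Pi.zero_apply]
          simp [this, weightedLpNorm_zero hp₂]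
    _ = _ := by rw [ENNReal.tsum_mul_right, ENNReal.tsum_mul_right]

theorem idIsNuclear_of_lt (hγ : ∀ i, 1 ≤ γ i) (hp₁' : 1 ≤ p₁) (hp₂' : 1 ≤ p₂)
    (hδ : ∀ i, 1 < ((p₁⁻¹).toReal - (p₂⁻¹).toReal) * γ i)
    (hσ : (∑ i, ((γ i : ℝ) - 1)) * ((p₁⁻¹).toReal - (p₂⁻¹).toReal) < σ₁ - σ₂) :
    IdIsNuclear (BesovSeq (blockWeight γ) σ₁ p₁ q₁ hp₁ hq₁)
      (BesovSeq (blockWeight γ) σ₂ p₂ q₂ hp₂ hq₂) := by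
  obtain ⟨U, hU, hU'⟩ := exists_block_kernel m
  -- The gap in the level condition is halved: one `ε` makes the sum over all blocks converge, the
  -- other pays for the outer quasi-norm.
  obtain ⟨ε, hε⟩ : ∃ ε : ℝ, 2 * ε =
      σ₁ - σ₂ - (∑ i, ((γ i : ℝ) - 1)) * ((p₁⁻¹).toReal - (p₂⁻¹).toReal) :=
    ⟨(σ₁ - σ₂ - (∑ i, ((γ i : ℝ) - 1)) * ((p₁⁻¹).toReal - (p₂⁻¹).toReal)) / 2, by ring⟩
  have hε0 : 0 < ε := by linarith
  set B : ℕ × (Fin m → ℤ) → ℝ≥0∞ := blockBound γ (2 * (∑ i, (γ i : ℝ)) * (p₁⁻¹).toReal)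
      ((p₁⁻¹).toReal - (p₂⁻¹).toReal) ε with hB
  have hBsum : ∑' α, B α ≠ ∞ := tsum_blockBound_ne_top hε0 hδ
  set K : ℝ≥0∞ := weightedLpNorm q₂ (fun _ : ℕ => 1) (fun ν => 2 ^ (-(ν * ε))) with hK
  have hKtop : K ≠ ∞ := weightedLpNorm_two_rpow_ne_top hq₂.ne' hε0
  have herr : ∀ (x : BesovSeq (blockWeight γ) σ₁ p₁ q₁ hp₁ hq₁) (A : Finset (ℕ × (Fin m → ℤ))),
      besovSeqENorm (blockWeight γ) σ₂ p₂ q₂ ((x : ℕ → (Fin m → ℤ) → ℂ) -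
        ∑ α ∈ A, BesovSeq.blockCoeff U α.1 α.2 x • blockWave U α.1 α.2) ≤
      ((∑' α : {α // α ∉ A}, B α) *
        besovSeqENorm (blockWeight γ) σ₁ p₁ q₁ (x : ℕ → (Fin m → ℤ) → ℂ)) * K :=
    BesovSeq.besovSeqENorm_sub_sum_le hγ hp₁' hp₂' hq₂.ne' hU hU' hε
  have hbd : ∀ x : BesovSeq (blockWeight γ) σ₁ p₁ q₁ hp₁ hq₁,
      besovSeqENorm (blockWeight γ) σ₂ p₂ q₂ (x : ℕ → (Fin m → ℤ) → ℂ) ≤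
      (∑' α, B α) * K * besovSeqENorm (blockWeight γ) σ₁ p₁ q₁ (x : ℕ → (Fin m → ℤ) → ℂ) := by
    intro x
    -- With no terms subtracted, the error estimate is the boundedness of the embedding.
    have := herr x ∅
    rw [Finset.sum_empty, sub_zero] at this
    refine this.trans ?_
    rw [mul_right_comm]
    gcongr
    exact ENNReal.tsum_comp_le_tsum_of_injective Subtype.val_injective B
  have hle : BesovSeq (blockWeight γ) σ₁ p₁ q₁ hp₁ hq₁ ≤
      BesovSeq (blockWeight γ) σ₂ p₂ q₂ hp₂ hq₂ := fun x hx =>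
    (hbd ⟨x, hx⟩).trans_lt (ENNReal.mul_lt_top (ENNReal.mul_lt_top hBsum.lt_top hKtop.lt_top) hx)
  have hy : ∀ ν k, besovSeqENorm (blockWeight γ) σ₂ p₂ q₂ (blockWave U ν k) < ∞ := fun ν k =>
    (besovSeqENorm_blockWave_le hγ hp₂.ne' hq₂.ne' hU ν k).trans_lt (two_rpow_ne_top _).lt_top
  have hm' : Infinite (ℕ × (Fin m → ℤ)) := inferInstance
  obtain ⟨e⟩ : Nonempty (ℕ ≃ ℕ × (Fin m → ℤ)) := nonempty_equiv_of_countable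
  have hcoeff : ∀ ν k (x : BesovSeq (blockWeight γ) σ₁ p₁ q₁ hp₁ hq₁),
      ‖BesovSeq.blockCoeff U ν k x‖ ≤ 2 ^ (-((∑ i, (Nat.size (k i).natAbs : ℝ) +
        weightExponent γ ν k - 2 * ∑ i, (γ i : ℝ)) * (p₁⁻¹).toReal) - ν * σ₁) * ‖x‖ := by
    intro ν k x
    have := BesovSeq.enorm_blockCoeff_le hγ hp₁' hU ν k x
    rw [← BesovSeq.ofReal_norm_eq, ← ofReal_two_rpow, ← ENNReal.ofReal_mul (by positivity),
      ← ofReal_norm] at this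
    exact (ENNReal.ofReal_le_ofReal_iff
      (mul_nonneg (by positivity) (BesovSeq.norm_nonneg' x))).1 this
  have hprod : ∀ ν k, (2 : ℝ≥0∞) ^ (-((∑ i, (Nat.size (k i).natAbs : ℝ) +
        weightExponent γ ν k - 2 * ∑ i, (γ i : ℝ)) * (p₁⁻¹).toReal) - ν * σ₁) *
      besovSeqENorm (blockWeight γ) σ₂ p₂ q₂ (blockWave U ν k) ≤ B (ν, k) := by
    intro ν k
    refine (mul_le_mul' le_rfl
      (besovSeqENorm_blockWave_le (σ := σ₂) hγ hp₂.ne' hq₂.ne' hU ν k)).trans ?_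
    rw [block_exponent_eq hε]
    refine mul_le_of_le_one_left' ?_
    rw [← ENNReal.rpow_zero (x := 2)]
    refine ENNReal.rpow_le_rpow_of_exponent_le one_le_two ?_
    have : 0 ≤ (ν : ℝ) * ε := by positivity
    linarith
  refine ⟨hle, ⟨((∑' α, B α) * K).toReal, fun x => ?_⟩,
    fun j => BesovSeq.blockCoeff U (e j).1 (e j).2,
    fun j => ⟨blockWave U (e j).1 (e j).2, hy _ _⟩, fun j => ⟨_, hcoeff _ _⟩, ?_, fun x => ?_⟩
  · rw [BesovSeq.norm_def, BesovSeq.norm_def, ← ENNReal.toReal_mul]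
    exact ENNReal.toReal_mono (ENNReal.mul_ne_top (ENNReal.mul_ne_top hBsum hKtop) x.2.ne) (hbd x)
  · have hBe : Summable fun j => (B (e j)).toReal :=
      ENNReal.summable_toReal (by rwa [e.tsum_eq])
    refine Summable.of_nonneg_of_le
      (fun j => mul_nonneg (functionalNorm_nonneg _) (BesovSeq.norm_nonneg' _)) (fun j => ?_) hBe
    have hB1 : ∀ α, B α ≠ ∞ := ENNReal.ne_top_of_tsum_ne_top hBsum
    refine (mul_le_mul_of_nonneg_right (functionalNorm_le (by positivity) (hcoeff _ _))
      (BesovSeq.norm_nonneg' _)).trans ?_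
    rw [← ENNReal.ofReal_le_iff_le_toReal (hB1 _), ENNReal.ofReal_mul (by positivity),
      BesovSeq.ofReal_norm_eq, ofReal_two_rpow]
    exact hprod (e j).1 (e j).2
  · have htail : Tendsto (fun N => ((∑' α : {α // α ∉ (Finset.range N).map e.toEmbedding}, B α) *
        besovSeqENorm (blockWeight γ) σ₁ p₁ q₁ (x : ℕ → (Fin m → ℤ) → ℂ)) * K) atTop (𝓝 0) := by
      have h1 : Tendsto (fun N => (Finset.range N).map e.toEmbedding) atTop atTop := by
        refine tendsto_atTop_finset_of_monotone (fun a b hab => by simpa using hab) fun α => ?_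
        refine ⟨e.symm α + 1, Finset.mem_map.2 ⟨e.symm α, by simp, by simp⟩⟩
      have h2 := (ENNReal.tendsto_tsum_compl_atTop_zero hBsum).comp h1
      have h3 := ENNReal.Tendsto.mul_const (b :=
        besovSeqENorm (blockWeight γ) σ₁ p₁ q₁ (x : ℕ → (Fin m → ℤ) → ℂ)) h2 (Or.inr x.2.ne)
      have h4 := ENNReal.Tendsto.mul_const (b := K) h3 (Or.inr hKtop)
      rw [zero_mul, zero_mul] at h4
      exact h4
    have hlim : Tendsto (fun N => besovSeqENorm (blockWeight γ) σ₂ p₂ q₂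
        ((x : ℕ → (Fin m → ℤ) → ℂ) - ∑ α ∈ (Finset.range N).map e.toEmbedding,
          BesovSeq.blockCoeff U α.1 α.2 x • blockWave U α.1 α.2)) atTop (𝓝 0) :=
      tendsto_of_tendsto_of_tendsto_of_le_of_le tendsto_const_nhds htail (fun _ => zero_le)
        fun N => herr x _
    have h5 := (ENNReal.tendsto_toReal ENNReal.zero_ne_top).comp hlim
    rw [ENNReal.toReal_zero] at h5
    refine h5.congr fun N => ?_
    rw [BesovSeq.norm_def]
    simp only [Function.comp_apply, Finset.sum_map, Equiv.coe_toEmbedding]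
    congr 2
    push_cast
    rfl

end Sufficiency

/-! ### The equivalence. -/

theorem proposition6 (m : ℕ) (hm : 0 < m) (γ : Fin m → ℕ) (hγ_mono : Monotone γ)
    (hγ : 2 ≤ γ ⟨0, hm⟩) (d : ℕ) (hd : d = ∑ i, γ i)
    (p₁ p₂ q₁ q₂ : ℝ≥0∞) (hp₁ : 1 ≤ p₁) (hp₂ : 1 ≤ p₂) (hq₁ : 0 < q₁) (hq₂ : 0 < q₂)
    (s₁ s₂ σ₁ σ₂ : ℝ)
    (hσ₁ : σ₁ = s₁ + (m : ℝ) / 2 - (m : ℝ) * (p₁⁻¹).toReal)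
    (hσ₂ : σ₂ = s₂ + (m : ℝ) / 2 - (m : ℝ) * (p₂⁻¹).toReal) :
    IdIsNuclear
        (BesovSeq (blockWeight γ) σ₁ p₁ q₁ (zero_lt_one.trans_le hp₁) hq₁)
        (BesovSeq (blockWeight γ) σ₂ p₂ q₂ (zero_lt_one.trans_le hp₂) hq₂) ↔
      (s₁ - s₂) / (d : ℝ) > (p₁⁻¹).toReal - (p₂⁻¹).toReal ∧
        (p₁⁻¹).toReal - (p₂⁻¹).toReal > 1 / (γ ⟨0, hm⟩ : ℝ) := by
  have hmin : ∀ i, γ ⟨0, hm⟩ ≤ γ i := fun i => hγ_mono (Nat.zero_le i.val)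
  have hγ1 : ∀ i, 1 ≤ γ i := fun i => (by omega : 1 ≤ γ ⟨0, hm⟩).trans (hmin i)
  have hd' : (d : ℝ) = ∑ i, (γ i : ℝ) := by rw [hd]; push_cast; rfl
  have hd0 : (0 : ℝ) < d := by
    have h1 : γ ⟨0, hm⟩ ≤ d := hd ▸ Finset.single_le_sum (fun _ _ => Nat.zero_le _)
      (Finset.mem_univ (⟨0, hm⟩ : Fin m))
    exact_mod_cast (by omega : 0 < d)
  have hg0 : (0 : ℝ) < γ ⟨0, hm⟩ := by exact_mod_cast (by omega : 0 < γ ⟨0, hm⟩)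
  -- The two forms differ by `m (1/p₁ - 1/p₂)` on both sides.
  have hlevel : (∑ i, ((γ i : ℝ) - 1)) * ((p₁⁻¹).toReal - (p₂⁻¹).toReal) < σ₁ - σ₂ ↔
      (s₁ - s₂) / (d : ℝ) > (p₁⁻¹).toReal - (p₂⁻¹).toReal := by
    rw [gt_iff_lt, lt_div_iff₀ hd0, Finset.sum_sub_distrib, ← hd', Finset.sum_const,
      Finset.card_univ, Fintype.card_fin, nsmul_eq_mul, mul_one, hσ₁, hσ₂, ← sub_pos,
      ← sub_pos (a := s₁ - s₂)]
    ring_nf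
  constructor
  · intro h
    exact ⟨hlevel.1 (lt_of_idIsNuclear_of_level hγ1 h), one_div_lt_of_idIsNuclear hγ1 _ hγ h⟩
  · rintro ⟨h1, h2⟩
    refine idIsNuclear_of_lt hγ1 hp₁ hp₂ (fun i => ?_) (hlevel.2 h1)
    have h3 : 1 < ((p₁⁻¹).toReal - (p₂⁻¹).toReal) * γ ⟨0, hm⟩ := (div_lt_iff₀ hg0).1 h2
    refine h3.trans_le (mul_le_mul_of_nonneg_left (by exact_mod_cast hmin i) ?_)
    exact (one_div_pos.2 hg0).le.trans h2.le
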